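/- Let $1<p<\infty$, let $L^p$ and $L^\infty$ be the complex Lebesgue spaces on the unit circle $\mathbb T$, let $H^p\subset L^p$ be the Hardy space of all $f\in L^p$ whose Fourier coefficients of negative index vanish, and let $P:L^p\to H^p$, $\sum_{n\in\mathbb Z} f_nt^n\mapsto\sum_{n\ge 0}f_nt^n$, be the Riesz projection. For $a\in L^\infty$ let $T(a):H^p\to H^p$, $f\mapsto P(af)$, be the Toeplitz operator with symbol $a$; for a matrix symbol $A\in (L^\infty)^{2\times 2}$ the operator $T(A)$ on $H^p\times H^p$ is defined by $f\mapsto P(Af)$ with $P$ acting entrywise. For a Fredholm operator $B$ put $\operatorname{ind}B=\dim\ker B-\dim\operatorname{coker}B$. Let $\mathbb Z_+$ and $\mathbb Z_-$ be the sets of nonnegative and of negative integers, and for an integer $m\ge 0$ put $P_{m-1}:=I-T(t^m)T(t^{-m})$ (so $P_{-1}=0$). Let $u,v,w\in L^\infty$ and $$G=\begin{pmatrix}0&-v\\ u&w\end{pmatrix}.$$ Suppose that at least one of the operators $T(u)$, $T(v)$ is Fredholm. Then $T(G)$ is Fredholm if and only if both $T(u)$ and $T(v)$ are Fredholm. If both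 are Fredholm, then $$\operatorname{ind}T(G)=\operatorname{ind}\operatorname{diag}(T(v),T(u))=\operatorname{ind}T(v)+\operatorname{ind}T(u).$$ Moreover, let $\kappa_1=\operatorname{ind}T(v)$ and $\kappa_2=\operatorname{ind}T(u)$. (i) If $(\kappa_1,\kappa_2)$ belongs to one of the sets $\mathbb Z_+\times\mathbb Z_+$, $\mathbb Z_-\times\mathbb Z_+$, $\mathbb Z_-\times\mathbb Z_-$, then $$\dim\ker T(G)=\dim\ker\operatorname{diag}(T(v),T(u)).$$ (ii) If $(\kappa_1,\kappa_2)\in\mathbb Z_+\times\mathbb Z_-$, put $u_0=u\,t^{\kappa_2}$ and $v_0=v\,t^{\kappa_1}$. Then $T(u_0)$ and $T(v_0)$ are invertible and $$\dim\ker T(G)=\dim\ker\Bigl(P_{-\kappa_2-1}T^{-1}(u_0)T(w)\big|_{\ker T(v)}\Bigr)=\dim\ker\Bigl(P_{-\kappa_2-1}T^{-1}(u_0)T(w)T^{-1}(v_0)\big|_{\operatorname{im}P_{\kappa_1-1}}\Bigr).$$ -/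

import Mathlib

open MeasureTheory
open scoped ENNReal

noncomputable section

namespace ToeplitzCircle

/-- The unit circle, parametrised by `θ ↦ e^{iθ}`, `θ ∈ ℝ / 2πℤ`. -/
abbrev T : Type := AddCircle (2 * Real.pi)

instance factTwoPiPos : Fact (0 < 2 * Real.pi) := ⟨Real.two_pi_pos⟩

/-- Normalised arc length `dθ / 2π` on the circle. -/
abbrev arc : Measure T := AddCircle.haarAddCircle

/-- The complex space `L^p` of the circle. -/
abbrev LpT (p : ℝ≥0∞) : Type := Lp ℂ p arc

/-- The symbol space `L^∞` of the circle. -/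
abbrev Symb : Type := Lp ℂ ∞ arc

/-- The symbol `t ↦ t^n`, `n ∈ ℤ`. -/
def tPow (n : ℤ) : Symb := fourierLp ∞ n

/-- The pointwise product of two symbols. -/
def symbMul (u v : Symb) : Symb := (ContinuousLinearMap.mul ℂ ℂ).holder ∞ u v

lemma integrable_of_LpT {p : ℝ≥0∞} [Fact (1 ≤ p)] (f : LpT p) : Integrable f arc :=
  memLp_one_iff_integrable.1 ((Lp.memLp f).mono_exponent Fact.out)

/-- The Hardy space `H^p`: all `f ∈ L^p` whose Fourier coefficients of negative index vanish. -/
def Hardy (p : ℝ≥0∞) [Fact (1 ≤ p)] : Submodule ℂ (LpT p) where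
  carrier := {f | ∀ n : ℤ, n < 0 → fourierCoeff f n = 0}
  zero_mem' := by
    intro n _
    rw [fourierCoeff_congr_ae (Lp.coeFn_zero ℂ p arc)]
    simp [fourierCoeff]
  add_mem' := by
    intro f g hf hg n hn
    rw [fourierCoeff_congr_ae (Lp.coeFn_add f g),
      fourierCoeff.add (integrable_of_LpT f) (integrable_of_LpT g), Pi.add_apply,
      hf n hn, hg n hn, add_zero]
  smul_mem' := by
    intro c f hf n hn
    rw [fourierCoeff_congr_ae (Lp.coeFn_smul c f), fourierCoeff.const_smul, hf n hn, smul_zero]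

variable (p : ℝ≥0∞) [Fact (1 ≤ p)]

open Classical in
/-- The Riesz projection `P : L^p → H^p`, `∑_{n ∈ ℤ} f_n tⁿ ↦ ∑_{n ≥ 0} f_n tⁿ`: the bounded
operator that keeps the Fourier coefficients of nonnegative index and kills the other ones.
For `1 < p < ∞` such an operator exists (M. Riesz) and is unique, so that the second branch is
never used there. -/
def riesz : LpT p →L[ℂ] Hardy p :=
  if h : ∃ P : LpT p →L[ℂ] Hardy p,
      ∀ (f : LpT p) (n : ℤ), 0 ≤ n → fourierCoeff (P f : LpT p) n = fourierCoeff f n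
  then h.choose else 0

/-- Multiplication by `u ∈ L^∞` on `L^p`. -/
def mulOp (u : Symb) : LpT p →L[ℂ] LpT p :=
  (ContinuousLinearMap.mul ℂ ℂ).holderL arc ∞ p p u

/-- The Toeplitz operator `T(u) : H^p → H^p`, `f ↦ P(u f)`. -/
def toeplitz (u : Symb) : Hardy p →L[ℂ] Hardy p :=
  riesz p ∘L mulOp p u ∘L (Hardy p).subtypeL

/-- Multiplication of column vectors in `L^p × L^p` by a `2 × 2` matrix over `L^∞`. -/
def mulMatrixOp (G : Matrix (Fin 2) (Fin 2) Symb) : (LpT p × LpT p) →L[ℂ] (LpT p × LpT p) :=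
  ((mulOp p (G 0 0)).coprod (mulOp p (G 0 1))).prod
    ((mulOp p (G 1 0)).coprod (mulOp p (G 1 1)))

/-- The Toeplitz operator `T(G)` on `H^p × H^p` with a `2 × 2` matrix symbol `G`, that is
`f ↦ P(G f)` where `P` acts on each entry of the column. -/
def toeplitzMatrix (G : Matrix (Fin 2) (Fin 2) Symb) :
    (Hardy p × Hardy p) →L[ℂ] (Hardy p × Hardy p) :=
  (riesz p).prodMap (riesz p) ∘L mulMatrixOp p G ∘L
    (Hardy p).subtypeL.prodMap (Hardy p).subtypeL

/-- `ind A = dim ker A - dim coker A`. -/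
def ind {E : Type} [NormedAddCommGroup E] [NormedSpace ℂ E] (A : E →L[ℂ] E) : ℤ :=
  A.toLinearMap.index

/-- `dim ker A`, as a cardinal. -/
def dimKer {E : Type} [NormedAddCommGroup E] [NormedSpace ℂ E] (A : E →L[ℂ] E) : Cardinal :=
  Module.rank ℂ (LinearMap.ker A.toLinearMap)

/-- `dim ker (A|_S)`, the dimension of the kernel of the restriction of `A` to a subspace `S`. -/
def dimKerOn {E : Type} [NormedAddCommGroup E] [NormedSpace ℂ E] (A : E →L[ℂ] E)
    (S : Submodule ℂ E) : Cardinal :=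
  Module.rank ℂ (LinearMap.ker (A.toLinearMap.domRestrict S))

/-- `P_k = I - T(t^{k+1}) T(t^{-k-1})`; in particular `P_{-1} = 0`. -/
def partialSum (k : ℤ) : Hardy p →L[ℂ] Hardy p :=
  ContinuousLinearMap.id ℂ (Hardy p) -
    toeplitz p (tPow (k + 1)) ∘L toeplitz p (tPow (-(k + 1)))

end ToeplitzCircle

end

/-!
Multiplying out shows that `T(G)` is the block operator `(f, g) ↦ (-T(v) g, T(u) f + T(w) g)`, that is
`diag(T(v), I) ∘ S ∘ diag(T(u), I)` with the invertible `S (f, g) = (-g, f + T(w) g)`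
(`blockOp_eq_comp`). Fredholm operators can be cancelled in a composition, which gives the
Fredholm criterion as soon as `T(u)` or `T(v)` is Fredholm, and the index is additive
(`ind_blockOp`).

The kernels are governed by Coburn's lemma: a Fredholm `T(u)` is injective or surjective
(`injective_or_surjective_of_isFredholm`), hence surjective for `ind T(u) ≥ 0` and injective for
`ind T(u) ≤ 0`. If `T(u)` is surjective, the substitution `f ↦ f + R T(w) g` with a linear right
inverse `R` of `T(u)` removes `T(w)` from the kernel equations; if `T(u)` and `T(v)` are
injective, both kernels vanish. In the remaining case `T(u) = T(u₀) T(t^n)` with `n = -κ₂` and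
`T(u₀)` invertible, so that `T(u) f = -T(w) g` is solvable precisely when `T(u₀)⁻¹ T(w) g` lies in
the range of `T(t^n)`, which is the kernel of `P_{n-1}`. Finally `T(v) = T(t^{-m}) T(v₀)` with
`m = κ₁` shows that `T(v₀)` maps the kernel of `T(v)` onto that of `T(t^{-m})`, the range of
`P_{m-1}`.

Coburn's lemma is proved here by a product of power series rather than by the theorem of F. and
M. Riesz. Suppose that `T(u) f = 0`, that the functional `φ` vanishes on the range of `T(u)`, and
put `φ_i = φ (t^i)` and `h_j = (u f)_{-j-1}`. Applying `φ` to `T(u) (t^k f)`, which is a polynomial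
with coefficients among the `h_j`, yields `(∑ φ_i z^i) (∑ h_j z^j) = 0`. So `φ = 0` or `u f = 0`, and
the latter forces `f = 0` when `ker T(u)` has finite dimension.

The operators are only meaningful because the Riesz projection is bounded (`exists_riesz`). For
`1 < p ≤ 2` this rests on the inequality `‖z‖ ^ p ≤ A (Re z) ^ p - B Re (z ^ p)` in the right half-plane
(`exists_norm_rpow_le_re_rpow_sub`): integrated over the boundary values of an analytic polynomial
with positive real part, whose `p`-th power obeys the mean value property, it bounds the
polynomial by its real part (`exists_lpNorm_le_lpNorm_re`). The passage from `p` to `2p`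
(`RieszBound.doubling`) reaches all finite exponents.
-/

noncomputable section

namespace ToeplitzCircle

/-! ### Fourier coefficients on `L^p` of the circle -/

lemma norm_fourierCoeff_le {p : ℝ≥0∞} [Fact (1 ≤ p)] (f : LpT p) (n : ℤ) :
    ‖fourierCoeff f n‖ ≤ ‖f‖ := by
  have h1 : ‖fourierCoeff f n‖ ≤ ∫ x, ‖f x‖ ∂arc := by
    refine (norm_integral_le_integral_norm _).trans_eq (integral_congr_ae (.of_forall fun x ↦ ?_))
    simp only [norm_smul, fourier_apply, Circle.norm_coe, one_mul]
  refine h1.trans ?_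
  rw [integral_norm_eq_lintegral_enorm (Lp.aestronglyMeasurable f), Lp.norm_def,
    ← eLpNorm_one_eq_lintegral_enorm]
  exact ENNReal.toReal_mono (Lp.eLpNorm_ne_top f)
    (eLpNorm_le_eLpNorm_of_exponent_le Fact.out (Lp.aestronglyMeasurable f))

/-- The `n`-th Fourier coefficient as a bounded functional on `L^p`. -/
def coeff (p : ℝ≥0∞) [Fact (1 ≤ p)] (n : ℤ) : LpT p →L[ℂ] ℂ :=
  LinearMap.mkContinuous
    { toFun := fun f ↦ fourierCoeff f n
      map_add' := fun f g ↦ by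
        rw [fourierCoeff_congr_ae (Lp.coeFn_add f g),
          fourierCoeff.add (integrable_of_LpT f) (integrable_of_LpT g), Pi.add_apply]
      map_smul' := fun c f ↦ by
        rw [fourierCoeff_congr_ae (Lp.coeFn_smul c f), fourierCoeff.const_smul, RingHom.id_apply] }
    1 fun f ↦ by simpa using norm_fourierCoeff_le f n

section Coefficients

variable {p : ℝ≥0∞} [Fact (1 ≤ p)]

lemma coeff_apply (f : LpT p) (n : ℤ) : coeff p n f = fourierCoeff f n := rfl

lemma mem_hardy_iff (f : LpT p) : f ∈ Hardy p ↔ ∀ n : ℤ, n < 0 → coeff p n f = 0 := Iff.rfl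

lemma coeff_hardy_of_neg (f : Hardy p) {n : ℤ} (hn : n < 0) : coeff p n (f : LpT p) = 0 :=
  f.2 n hn

lemma isClosed_hardy : IsClosed (Hardy p : Set (LpT p)) := by
  have : (Hardy p : Set (LpT p)) = ⋂ (n : ℤ) (_ : n < 0), {f | coeff p n f = 0} := by
    ext f; simp [mem_hardy_iff]
  rw [this]
  exact isClosed_iInter fun n ↦ isClosed_iInter fun _ ↦
    isClosed_eq (coeff p n).continuous continuous_const

instance completeSpace_hardy : CompleteSpace (Hardy p) :=
  isClosed_hardy.completeSpace_coe

/-- If the Fourier coefficients of an integrable function vanish, it is orthogonal to every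
continuous function, since trigonometric polynomials are uniformly dense. -/
lemma integral_continuousMap_mul_eq_zero {f : T → ℂ} (hf : Integrable f arc)
    (h : ∀ n, fourierCoeff f n = 0) (φ : C(T, ℂ)) : ∫ x, φ x * f x ∂arc = 0 := by
  have hint : ∀ φ : C(T, ℂ), Integrable (fun x ↦ φ x * f x) arc := fun φ ↦
    hf.bdd_mul (c := ‖φ‖) φ.continuous.aestronglyMeasurable
      (.of_forall fun x ↦ φ.norm_coe_le_norm x)
  let Φ : C(T, ℂ) →L[ℂ] ℂ := LinearMap.mkContinuous
    { toFun := fun φ ↦ ∫ x, φ x * f x ∂arc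
      map_add' := fun φ ψ ↦ by
        simp only [ContinuousMap.add_apply, add_mul]
        exact integral_add (hint φ) (hint ψ)
      map_smul' := fun c φ ↦ by
        simp only [ContinuousMap.smul_apply, smul_eq_mul, mul_assoc, RingHom.id_apply]
        exact integral_const_mul c _ }
    (∫ x, ‖f x‖ ∂arc) fun φ ↦ by
      refine (norm_integral_le_of_norm_le (hf.norm.const_mul ‖φ‖)
        (.of_forall fun x ↦ ?_)).trans_eq ((integral_const_mul _ _).trans (mul_comm _ _))
      rw [norm_mul]
      gcongr
      exact φ.norm_coe_le_norm x
  have hspan : Submodule.span ℂ (Set.range (@fourier (2 * Real.pi))) ≤ Φ.ker := by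
    rw [Submodule.span_le]
    rintro _ ⟨n, rfl⟩
    change ∫ x, fourier n x * f x ∂arc = 0
    simpa [fourierCoeff] using h (-n)
  have hclosed : IsClosed (Φ.ker : Set C(T, ℂ)) := Φ.isClosed_ker
  have htop := Submodule.topologicalClosure_minimal _ hspan hclosed
  rw [span_fourier_closure_eq_top] at htop
  exact htop (Submodule.mem_top : φ ∈ ⊤)

lemma ae_eq_zero_of_fourierCoeff_eq_zero {f : T → ℂ} (hf : Integrable f arc)
    (h : ∀ n, fourierCoeff f n = 0) : f =ᵐ[arc] 0 := by
  refine ae_eq_zero_of_forall_setIntegral_isClosed_eq_zero hf fun F hF ↦ ?_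
  have hδ : Filter.Tendsto (fun n : ℕ ↦ (1 : ℝ) / (n + 1)) Filter.atTop (nhds 0) :=
    tendsto_one_div_add_atTop_nhds_zero_nat
  have hpos : ∀ n : ℕ, (0 : ℝ) < 1 / (n + 1) := fun n ↦ by positivity
  let φ : ℕ → C(T, ℂ) := fun n ↦ ⟨fun x ↦ ((thickenedIndicator (hpos n) F x : ℝ) : ℂ), by fun_prop⟩
  have hlim : Filter.Tendsto (fun n ↦ ∫ x, φ n x * f x ∂arc) Filter.atTop
      (nhds (∫ x, F.indicator f x ∂arc)) := by
    refine tendsto_integral_of_dominated_convergence (fun x ↦ ‖f x‖) (fun n ↦ ?_) hf.norm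
      (fun n ↦ .of_forall fun x ↦ ?_) (.of_forall fun x ↦ ?_)
    · exact (φ n).continuous.aestronglyMeasurable.mul hf.1
    · rw [norm_mul]
      refine mul_le_of_le_one_left (norm_nonneg _) ?_
      have := thickenedIndicator_le_one (hpos n) F x
      simpa [φ] using this
    · have h1 := thickenedIndicator_tendsto_indicator_closure hpos hδ F
      rw [hF.closure_eq] at h1
      have h2 : Filter.Tendsto (fun n ↦ ((thickenedIndicator (hpos n) F x : ℝ) : ℂ)) Filter.atTop
          (nhds (((F.indicator (fun _ ↦ (1 : NNReal)) x : NNReal) : ℝ) : ℂ)) :=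
        ((Complex.continuous_ofReal.comp NNReal.continuous_coe).tendsto _).comp
          (tendsto_pi_nhds.1 h1 x)
      have h3 : F.indicator f x =
          (((F.indicator (fun _ ↦ (1 : NNReal)) x : NNReal) : ℝ) : ℂ) * f x := by
        by_cases hx : x ∈ F <;> simp [hx]
      rw [h3]
      exact h2.mul_const (f x)
  rw [← integral_indicator hF.measurableSet]
  refine tendsto_nhds_unique hlim ?_
  simp only [integral_continuousMap_mul_eq_zero hf h]
  exact tendsto_const_nhds

/-- A function in `L^p` is determined by its Fourier coefficients. -/
lemma ext_coeff {f g : LpT p} (h : ∀ n, coeff p n f = coeff p n g) : f = g := by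
  rw [← sub_eq_zero, Lp.eq_zero_iff_ae_eq_zero]
  refine ae_eq_zero_of_fourierCoeff_eq_zero (integrable_of_LpT _) fun n ↦ ?_
  rw [← coeff_apply, map_sub, h, sub_self]

lemma ext_coeff_hardy {f g : Hardy p}
    (h : ∀ n : ℤ, 0 ≤ n → coeff p n (f : LpT p) = coeff p n (g : LpT p)) : f = g := by
  refine Subtype.ext (ext_coeff fun n ↦ ?_)
  rcases lt_or_ge n 0 with hn | hn
  · rw [coeff_hardy_of_neg f hn, coeff_hardy_of_neg g hn]
  · exact h n hn

lemma coeff_toLp (φ : C(T, ℂ)) (n : ℤ) :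
    coeff p n (ContinuousMap.toLp p arc ℂ φ) = fourierCoeff φ n :=
  congrFun (fourierCoeff_congr_ae (ContinuousMap.coeFn_toLp arc φ)) n

lemma coeff_fourierLp (m n : ℤ) :
    coeff p n (fourierLp p m) = if n = m then 1 else 0 := by
  rw [coeff_toLp, fourierCoeff_fourier, Pi.single_apply]

/-! ### Multiplication by symbols -/

lemma coeFn_mulOp (u : Symb) (f : LpT p) : mulOp p u f =ᵐ[arc] fun x ↦ u x * f x :=
  (ContinuousLinearMap.mul ℂ ℂ).coeFn_holder u f

lemma coeff_mulOp_tPow (k n : ℤ) (f : LpT p) :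
    coeff p n (mulOp p (tPow k) f) = coeff p (n - k) f := by
  refine integral_congr_ae ?_
  filter_upwards [coeFn_mulOp (tPow k) f, coeFn_fourierLp ∞ k] with x h1 h2
  change fourierLp ∞ k x = _ at h2
  have h3 : (tPow k : Symb) x = fourier k x := h2
  rw [h1, h3, smul_eq_mul, smul_eq_mul, ← mul_assoc, ← fourier_add]
  congr 2; ring_nf

lemma mulOp_symbMul (u v : Symb) (f : LpT p) :
    mulOp p (symbMul u v) f = mulOp p u (mulOp p v f) := by
  refine Lp.ext ?_
  filter_upwards [coeFn_mulOp (symbMul u v) f, coeFn_mulOp u (mulOp p v f), coeFn_mulOp v f,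
    (ContinuousLinearMap.mul ℂ ℂ).coeFn_holder (r := ∞) u v] with x h1 h2 h3 h4
  have h4' : (symbMul u v) x = u x * v x := h4
  rw [h1, h2, h3, h4', mul_assoc]

lemma mulOp_mulOp_comm (u v : Symb) (f : LpT p) :
    mulOp p u (mulOp p v f) = mulOp p v (mulOp p u f) := by
  refine Lp.ext ?_
  filter_upwards [coeFn_mulOp u (mulOp p v f), coeFn_mulOp v f, coeFn_mulOp v (mulOp p u f),
    coeFn_mulOp u f] with x h1 h2 h3 h4
  rw [h1, h2, h3, h4, mul_left_comm]

lemma mulOp_neg (u : Symb) : mulOp p (-u) = -mulOp p u := map_neg _ u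

end Coefficients

/-! ### An inequality for powers in the right half-plane -/

lemma exists_one_le_cos_rpow_sub_cos {s : ℝ} (hs1 : 1 < s) (hs2 : s ≤ 2) :
    ∃ A B : ℝ, 0 ≤ A ∧ 0 ≤ B ∧ ∀ θ : ℝ, 0 ≤ θ → θ ≤ Real.pi / 2 →
      1 ≤ A * Real.cos θ ^ s - B * Real.cos (θ * s) := by
  have hπ := Real.pi_pos
  -- For `θ₀ ≤ θ ≤ π / 2` the angle `θ s` stays in an interval on which the cosine is at most
  -- `cos (θ₀ s) < 0`; for `θ ≤ θ₀` the power `cos θ ^ s` is bounded below.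
  set θ₀ : ℝ := Real.pi / 4 * (1 + 1 / s) with hθ₀
  have hθ₀s : θ₀ * s = Real.pi / 4 * (s + 1) := by rw [hθ₀]; field_simp
  have hinv : 1 / s < 1 := by rw [div_lt_one (by linarith)]; exact hs1
  have hinv0 : 0 < 1 / s := by positivity
  have hθ₀0 : 0 < θ₀ := by positivity
  have hθ₀1 : θ₀ < Real.pi / 2 := by rw [hθ₀]; nlinarith
  have hc : Real.cos (θ₀ * s) < 0 := by
    rw [hθ₀s]
    exact Real.cos_neg_of_pi_div_two_lt_of_lt (by nlinarith) (by nlinarith)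
  have hcos : 0 < Real.cos θ₀ := Real.cos_pos_of_mem_Ioo ⟨by linarith, hθ₀1⟩
  set B : ℝ := (-Real.cos (θ₀ * s))⁻¹ with hB
  have hB0 : 0 < B := inv_pos.2 (by linarith)
  refine ⟨(1 + B) / Real.cos θ₀ ^ s, B, by positivity, hB0.le, fun θ h0 h1 ↦ ?_⟩
  rcases le_total θ θ₀ with h | h
  · have h2 : Real.cos θ₀ ^ s ≤ Real.cos θ ^ s :=
      Real.rpow_le_rpow hcos.le (Real.cos_le_cos_of_nonneg_of_le_pi h0 (by linarith) h) (by linarith)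
    have h3 : 1 + B ≤ (1 + B) / Real.cos θ₀ ^ s * Real.cos θ ^ s := by
      rw [div_mul_eq_mul_div, le_div_iff₀ (by positivity)]
      gcongr
    nlinarith [Real.cos_le_one (θ * s)]
  · have h2 : Real.cos (θ * s) ≤ Real.cos (θ₀ * s) :=
      Real.cos_le_cos_of_nonneg_of_le_pi (by positivity) (by nlinarith)
        (by gcongr)
    have h3 : 0 ≤ (1 + B) / Real.cos θ₀ ^ s * Real.cos θ ^ s := by
      have : 0 ≤ Real.cos θ := Real.cos_nonneg_of_mem_Icc ⟨by linarith, h1⟩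
      positivity
    have h4 : B * -Real.cos (θ₀ * s) = 1 := inv_mul_cancel₀ (by linarith)
    nlinarith

/-- For `1 < s ≤ 2` the power `‖z‖ ^ s` is dominated on the right half-plane by a multiple of
`(Re z) ^ s` up to the harmonic function `Re (z ^ s)`. -/
lemma exists_norm_rpow_le_re_rpow_sub {s : ℝ} (hs1 : 1 < s) (hs2 : s ≤ 2) :
    ∃ A B : ℝ, 0 ≤ A ∧ 0 ≤ B ∧ ∀ z : ℂ, 0 < z.re →
      ‖z‖ ^ s ≤ A * z.re ^ s - B * (z ^ (s : ℂ)).re := by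
  obtain ⟨A, B, hA, hB, h⟩ := exists_one_le_cos_rpow_sub_cos hs1 hs2
  refine ⟨A, B, hA, hB, fun z hz ↦ ?_⟩
  have harg : |z.arg| < Real.pi / 2 := Complex.abs_arg_lt_pi_div_two_iff.2 (.inl hz)
  have hcos : 0 ≤ Real.cos z.arg :=
    (Real.cos_pos_of_mem_Ioo ⟨by linarith [(abs_lt.1 harg).1], (abs_lt.1 harg).2⟩).le
  have h1 := h |z.arg| (abs_nonneg _) harg.le
  have h2 : Real.cos (|z.arg| * s) = Real.cos (z.arg * s) := by
    rw [← Real.cos_abs (z.arg * s), abs_mul, abs_of_pos (by linarith : 0 < s)]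
  rw [Real.cos_abs, h2] at h1
  rw [Complex.cpow_ofReal_re, ← Complex.norm_mul_cos_arg z,
    Real.mul_rpow (norm_nonneg _) hcos]
  nlinarith [Real.rpow_nonneg (norm_nonneg z) s]

/-! ### Trigonometric polynomials with prescribed spectrum -/

/-- The trigonometric polynomials whose spectrum lies in `S ⊆ ℤ`. -/
def trigSpan (S : Set ℤ) : Submodule ℂ C(T, ℂ) :=
  Submodule.span ℂ (fourier '' S)

lemma fourier_mem_trigSpan {S : Set ℤ} {n : ℤ} (hn : n ∈ S) : fourier n ∈ trigSpan S :=
  Submodule.subset_span ⟨n, hn, rfl⟩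

lemma trigSpan_mono {S S' : Set ℤ} (h : S ⊆ S') : trigSpan S ≤ trigSpan S' :=
  Submodule.span_mono (Set.image_mono h)

lemma mul_mem_trigSpan {S S' S'' : Set ℤ} (h : ∀ m ∈ S, ∀ n ∈ S', m + n ∈ S'')
    {a b : C(T, ℂ)} (ha : a ∈ trigSpan S) (hb : b ∈ trigSpan S') : a * b ∈ trigSpan S'' := by
  induction ha, hb using Submodule.span_induction₂ with
  | mem_mem x y hx hy =>
    obtain ⟨m, hm, rfl⟩ := hx
    obtain ⟨n, hn, rfl⟩ := hy
    have : (fourier m * fourier n : C(T, ℂ)) = fourier (m + n) := by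
      ext x; exact fourier_add.symm
    rw [this]
    exact fourier_mem_trigSpan (h m hm n hn)
  | zero_left y hy => simp
  | zero_right x hx => simp
  | add_left x y z _ _ _ h1 h2 => rw [add_mul]; exact add_mem h1 h2
  | add_right x y z _ _ _ h1 h2 => rw [mul_add]; exact add_mem h1 h2
  | smul_left r x y _ _ h1 => rw [smul_mul_assoc]; exact Submodule.smul_mem _ _ h1
  | smul_right r x y _ _ h1 => rw [mul_smul_comm]; exact Submodule.smul_mem _ _ h1

lemma star_mem_trigSpan {S S' : Set ℤ} (h : ∀ m ∈ S, -m ∈ S') {a : C(T, ℂ)}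
    (ha : a ∈ trigSpan S) : star a ∈ trigSpan S' := by
  induction ha using Submodule.span_induction with
  | mem x hx =>
    obtain ⟨m, hm, rfl⟩ := hx
    have : star (fourier m : C(T, ℂ)) = fourier (-m) := by
      ext x; exact fourier_neg.symm
    rw [this]
    exact fourier_mem_trigSpan (h m hm)
  | zero => simp
  | add x y _ _ h1 h2 => rw [star_add]; exact add_mem h1 h2
  | smul r x _ h1 => rw [star_smul]; exact Submodule.smul_mem _ _ h1

lemma integrable_continuousMap (φ : C(T, ℂ)) : Integrable φ arc :=
  φ.continuous.integrable_of_hasCompactSupport (HasCompactSupport.of_compactSpace _)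

lemma integral_fourier (n : ℤ) : ∫ x, fourier n x ∂arc = if n = 0 then 1 else 0 := by
  have := congrFun (fourierCoeff_fourier (T := 2 * Real.pi) n) 0
  simp only [fourierCoeff, neg_zero, fourier_zero, one_smul, Pi.single_apply] at this
  rw [this]
  simp only [eq_comm]

lemma sub_integral_mem_trigSpan {a : C(T, ℂ)} (ha : a ∈ trigSpan (Set.Iic 0)) :
    a - ContinuousMap.const T (∫ x, a x ∂arc) ∈ trigSpan (Set.Iio 0) := by
  induction ha using Submodule.span_induction with
  | mem x hx =>
    obtain ⟨n, hn, rfl⟩ := hx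
    rw [integral_fourier]
    split_ifs with h
    · have : (fourier n - ContinuousMap.const T 1 : C(T, ℂ)) = 0 := by
        ext x; subst h; simp
      rw [this]; exact zero_mem _
    · have : (fourier n - ContinuousMap.const T 0 : C(T, ℂ)) = fourier n := by
        ext x; simp
      rw [this]; exact fourier_mem_trigSpan (lt_of_le_of_ne hn h)
  | zero =>
    convert zero_mem (trigSpan (Set.Iio 0))
    ext; simp
  | add x y _ _ h1 h2 =>
    convert add_mem h1 h2 using 1
    ext t
    simp only [ContinuousMap.add_apply, ContinuousMap.sub_apply, ContinuousMap.const_apply]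
    rw [integral_add (integrable_continuousMap x) (integrable_continuousMap y)]
    ring
  | smul r x _ h1 =>
    convert Submodule.smul_mem _ r h1 using 1
    ext t
    simp only [ContinuousMap.smul_apply, ContinuousMap.sub_apply, ContinuousMap.const_apply,
      integral_smul, smul_sub]

lemma integral_eq_zero_of_mem_trigSpan {S : Set ℤ} (hS : (0 : ℤ) ∉ S) {a : C(T, ℂ)}
    (ha : a ∈ trigSpan S) : ∫ x, a x ∂arc = 0 := by
  induction ha using Submodule.span_induction with
  | mem x hx =>
    obtain ⟨n, hn, rfl⟩ := hx
    rw [integral_fourier, if_neg (by rintro rfl; exact hS hn)]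
  | zero => simp
  | add x y _ _ h1 h2 =>
    simp only [ContinuousMap.add_apply]
    rw [integral_add (integrable_continuousMap x) (integrable_continuousMap y), h1, h2, add_zero]
  | smul r x _ h1 =>
    simp only [ContinuousMap.smul_apply, integral_smul, h1, smul_zero]

lemma exists_add_of_mem_trigSpan {f : C(T, ℂ)} (hf : f ∈ trigSpan Set.univ) :
    ∃ a ∈ trigSpan (Set.Ici 0), ∃ b ∈ trigSpan (Set.Iio 0), a + b = f := by
  have : (Set.univ : Set ℤ) = Set.Ici 0 ∪ Set.Iio 0 := (Set.Ici_union_Iio).symm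
  rw [trigSpan, this, Set.image_union, Submodule.span_union] at hf
  exact Submodule.mem_sup.1 hf

lemma dense_trigSpan : Dense (trigSpan Set.univ : Set C(T, ℂ)) := by
  rw [trigSpan, Set.image_univ, Submodule.dense_iff_topologicalClosure_eq_top]
  exact span_fourier_closure_eq_top

/-- A trigonometric polynomial with nonnegative spectrum is the boundary function of a
polynomial. -/
lemma exists_polynomial_of_mem_trigSpan {a : C(T, ℂ)} (ha : a ∈ trigSpan (Set.Ici 0)) :
    ∃ q : Polynomial ℂ, ∀ x, a x = q.eval (fourier 1 x) := by
  induction ha using Submodule.span_induction with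
  | mem x hx =>
    obtain ⟨n, hn, rfl⟩ := hx
    lift n to ℕ using hn
    refine ⟨Polynomial.X ^ n, fun x ↦ ?_⟩
    rw [Polynomial.eval_pow, Polynomial.eval_X]
    simp [AddCircle.toCircle_nsmul]
  | zero => exact ⟨0, fun x ↦ by simp⟩
  | add x y _ _ h1 h2 =>
    obtain ⟨q, hq⟩ := h1
    obtain ⟨r, hr⟩ := h2
    exact ⟨q + r, fun x ↦ by simp [hq, hr, -fourier_apply]⟩
  | smul c x _ h1 =>
    obtain ⟨q, hq⟩ := h1
    exact ⟨Polynomial.C c * q, fun x ↦ by simp [hq, -fourier_apply]⟩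

/-- Means over the circle as circle averages in the complex plane. -/
lemma integral_comp_fourier_one {F : ℂ → ℂ} :
    ∫ x, F (fourier 1 x) ∂arc = Real.circleAverage F 0 1 := by
  have h := fourierCoeff_eq_intervalIntegral (T := 2 * Real.pi) (fun x ↦ F (fourier 1 x)) 0 0
  simp only [fourierCoeff, neg_zero, fourier_zero, one_smul, zero_add] at h
  rw [h, Real.circleAverage_def, one_div]
  congr 1
  refine intervalIntegral.integral_congr fun θ _ ↦ ?_
  simp only [fourier_coe_apply, circleMap]
  congr 1
  have : (Real.pi : ℂ) ≠ 0 := by exact_mod_cast Real.pi_ne_zero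
  push_cast
  rw [zero_add, one_mul]
  congr 1
  field_simp

/-! ### The theorem of M. Riesz on the boundedness of the Riesz projection -/

lemma re_eval_pos_of_re_eval_pos_on_sphere {q : Polynomial ℂ}
    (h : ∀ z : ℂ, ‖z‖ = 1 → 0 < (q.eval z).re) {z : ℂ} (hz : ‖z‖ ≤ 1) : 0 < (q.eval z).re := by
  obtain ⟨w, hw, hmin⟩ := (isCompact_sphere (0 : ℂ) 1).exists_isMinOn
    (NormedSpace.sphere_nonempty.2 zero_le_one)
    (f := fun z ↦ (q.eval z).re) (by fun_prop)
  have hw1 := h w (by simpa using hw)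
  -- The maximum principle for `exp (-q)` gives a lower bound for `Re q`.
  have hd : Differentiable ℂ fun z ↦ Complex.exp (-q.eval z) := by fun_prop
  have := Complex.norm_le_of_forall_mem_frontier_norm_le (U := Metric.ball 0 1) (z := z)
    Metric.isBounded_ball (hd.diffContOnCl) (C := Real.exp (-(q.eval w).re)) (fun y hy ↦ by
      rw [frontier_ball _ one_ne_zero] at hy
      rw [Complex.norm_exp, Complex.neg_re, Real.exp_le_exp, neg_le_neg_iff]
      exact hmin hy) (by rw [closure_ball _ one_ne_zero]; simpa using hz)
  rw [Complex.norm_exp, Complex.neg_re, Real.exp_le_exp, neg_le_neg_iff] at this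
  linarith

lemma exists_fourier_one_eq {z : ℂ} (hz : ‖z‖ = 1) : ∃ x : T, fourier 1 x = z := by
  refine ⟨(z.arg : ℝ), ?_⟩
  rw [fourier_coe_apply]
  have hπ : (Real.pi : ℂ) ≠ 0 := by exact_mod_cast Real.pi_ne_zero
  conv_rhs => rw [← Complex.norm_mul_exp_arg_mul_I z, hz, Complex.ofReal_one, one_mul]
  congr 1
  push_cast
  field_simp

/-- For `1 < p ≤ 2`, an analytic trigonometric polynomial of positive real part and real mean is
controlled in `L^p` by its real part: integrate the inequality
`exists_norm_rpow_le_re_rpow_sub`, whose harmonic term has a nonnegative mean. -/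
lemma exists_lpNorm_le_lpNorm_re {p : ℝ≥0∞} (hp1 : 1 < p) (hp2 : p ≤ 2) :
    ∃ K : ℝ, 0 ≤ K ∧ ∀ G ∈ trigSpan (Set.Ici 0), (∀ x, 0 < (G x).re) →
      (∫ x, G x ∂arc).im = 0 →
      lpNorm G p arc ≤ K * lpNorm (fun x ↦ (G x).re) p arc := by
  have hptop : p ≠ ∞ := (hp2.trans_lt (by simp)).ne
  have hp0 : p ≠ 0 := (zero_lt_one.trans hp1).ne'
  set s := p.toReal with hs
  have hs1 : 1 < s := by
    rw [hs, ← ENNReal.toReal_one]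
    exact (ENNReal.toReal_lt_toReal (by simp) hptop).2 hp1
  have hs2 : s ≤ 2 := by
    rw [hs, ← ENNReal.toReal_ofNat]
    exact (ENNReal.toReal_le_toReal hptop (by simp)).2 hp2
  obtain ⟨A, B, hA, hB, hAB⟩ := exists_norm_rpow_le_re_rpow_sub hs1 hs2
  refine ⟨A ^ s⁻¹, by positivity, fun G hG hpos him ↦ ?_⟩
  obtain ⟨q, hq⟩ := exists_polynomial_of_mem_trigSpan hG
  have hqpos : ∀ z : ℂ, ‖z‖ ≤ 1 → 0 < (q.eval z).re := fun z hz ↦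
    re_eval_pos_of_re_eval_pos_on_sphere (fun z hz ↦ by
      obtain ⟨x, rfl⟩ := exists_fourier_one_eq hz
      rw [← hq]; exact hpos x) hz
  have hmean1 : ∫ x, G x ∂arc = q.eval 0 := by
    simp only [hq]
    rw [integral_comp_fourier_one (F := fun z ↦ q.eval z)]
    exact (Differentiable.diffContOnCl (by fun_prop)).circleAverage
  have hmean2 : ∫ x, G x ^ (s : ℂ) ∂arc = q.eval 0 ^ (s : ℂ) := by
    simp only [hq]
    rw [integral_comp_fourier_one (F := fun z ↦ q.eval z ^ (s : ℂ))]
    refine DiffContOnCl.circleAverage (f := fun z ↦ q.eval z ^ (s : ℂ)) ?_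
    refine DifferentiableOn.diffContOnCl_ball (U := Metric.closedBall 0 1) ?_ (by simp)
    intro z hz
    have : DifferentiableAt ℂ (fun z ↦ q.eval z) z := by fun_prop
    exact (this.cpow_const (Complex.mem_slitPlane_iff.2
      (.inl (hqpos z (by simpa using hz))))).differentiableWithinAt
  have hmean3 : 0 ≤ (∫ x, G x ^ (s : ℂ) ∂arc).re := by
    have h0 : q.eval 0 = ((q.eval 0).re : ℂ) := by
      apply Complex.ext
      · simp
      · simpa [hmean1] using him
    have h1 := hqpos 0 (by simp)
    rw [hmean2, h0, ← Complex.ofReal_cpow h1.le, Complex.ofReal_re]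
    positivity
  have hcont1 : Continuous fun x ↦ ‖G x‖ ^ s :=
    G.continuous.norm.rpow_const fun x ↦ .inr (by linarith)
  have hcont2 : Continuous fun x ↦ (G x).re ^ s :=
    (Complex.continuous_re.comp G.continuous).rpow_const fun x ↦ .inr (by linarith)
  have hcont3 : Continuous fun x ↦ G x ^ (s : ℂ) :=
    continuous_iff_continuousAt.2 fun x ↦ (G.continuous.continuousAt).cpow continuousAt_const
      (Complex.mem_slitPlane_iff.2 (.inl (hpos x)))
  have hcont4 : Continuous fun x ↦ (G x ^ (s : ℂ)).re := Complex.continuous_re.comp hcont3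
  have hcont5 : Continuous fun x ↦ (G x).re := Complex.continuous_re.comp G.continuous
  have hint : ∀ {E : Type} [NormedAddCommGroup E] {φ : T → E}, Continuous φ → Integrable φ arc :=
    fun h ↦ h.integrable_of_hasCompactSupport (HasCompactSupport.of_compactSpace _)
  have hle : ∫ x, ‖G x‖ ^ s ∂arc ≤ A * ∫ x, (G x).re ^ s ∂arc := by
    calc ∫ x, ‖G x‖ ^ s ∂arc
        ≤ ∫ x, (A * (G x).re ^ s - B * (G x ^ (s : ℂ)).re) ∂arc :=
          integral_mono (hint hcont1)
            (hint ((hcont2.const_mul A).sub (hcont4.const_mul B)))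
            fun x ↦ hAB _ (hpos x)
      _ = A * ∫ x, (G x).re ^ s ∂arc - B * (∫ x, G x ^ (s : ℂ) ∂arc).re := by
          rw [integral_sub (hint (hcont2.const_mul A))
            (hint (hcont4.const_mul B)), integral_const_mul,
            integral_const_mul]
          congr 2
          exact integral_re (hint hcont3)
      _ ≤ A * ∫ x, (G x).re ^ s ∂arc := by nlinarith
  rw [lpNorm_eq_integral_norm_rpow_toReal hp0 hptop G.continuous.aestronglyMeasurable,
    lpNorm_eq_integral_norm_rpow_toReal hp0 hptop
      hcont5.aestronglyMeasurable, ← hs,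
    ← Real.mul_rpow hA (integral_nonneg fun x ↦ by positivity)]
  refine Real.rpow_le_rpow (integral_nonneg fun x ↦ by positivity) ?_ (by positivity)
  refine hle.trans_eq ?_
  congr 2
  ext x
  rw [Real.norm_of_nonneg (hpos x).le]

lemma memLp_continuousMap (φ : C(T, ℂ)) (p : ℝ≥0∞) : MemLp φ p arc :=
  MemLp.of_bound φ.continuous.aestronglyMeasurable ‖φ‖ (.of_forall φ.norm_coe_le_norm)

lemma norm_toLp_eq_lpNorm (p : ℝ≥0∞) [Fact (1 ≤ p)] (φ : C(T, ℂ)) :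
    ‖ContinuousMap.toLp p arc ℂ φ‖ = lpNorm φ p arc := by
  rw [Lp.norm_def, eLpNorm_congr_ae (ContinuousMap.coeFn_toLp arc φ),
    toReal_eLpNorm φ.continuous.aestronglyMeasurable]

lemma lpNorm_continuousMap_mono {E : Type} [NormedAddCommGroup E] {φ : C(T, ℂ)} {g : T → E}
    {p : ℝ≥0∞} (hg : MemLp g p arc) (h : ∀ x, ‖φ x‖ ≤ ‖g x‖) :
    lpNorm φ p arc ≤ lpNorm g p arc := by
  rw [← lpNorm_norm hg.1]
  exact lpNorm_mono_real hg.norm h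

lemma lpNorm_continuousMap_le_norm {p : ℝ≥0∞} (hp : 1 ≤ p) (φ : C(T, ℂ)) :
    lpNorm φ p arc ≤ ‖φ‖ := by
  refine (lpNorm_mono_real (g := fun _ ↦ ‖φ‖) (memLp_const _)
    φ.norm_coe_le_norm).trans_eq ?_
  rw [lpNorm_const (zero_lt_one.trans_le hp).ne' (NeZero.ne arc)]
  simp

lemma lpNorm_continuousMap_mono_exponent {p q : ℝ≥0∞} (hpq : p ≤ q) (φ : C(T, ℂ)) :
    lpNorm φ p arc ≤ lpNorm φ q arc := by
  rw [← toReal_eLpNorm φ.continuous.aestronglyMeasurable,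
    ← toReal_eLpNorm φ.continuous.aestronglyMeasurable]
  exact ENNReal.toReal_mono (memLp_continuousMap φ q).2.ne
    (eLpNorm_le_eLpNorm_of_exponent_le hpq φ.continuous.aestronglyMeasurable)

lemma lpNorm_continuousMap_add_le {p : ℝ≥0∞} (hp : 1 ≤ p) (φ ψ : C(T, ℂ)) :
    lpNorm (φ + ψ : C(T, ℂ)) p arc ≤ lpNorm φ p arc + lpNorm ψ p arc :=
  lpNorm_add_le (memLp_continuousMap φ p) hp

lemma lpNorm_continuousMap_smul (p : ℝ≥0∞) (c : ℂ) (φ : C(T, ℂ)) :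
    lpNorm (c • φ : C(T, ℂ)) p arc = ‖c‖ * lpNorm φ p arc :=
  lpNorm_const_smul c φ arc

lemma norm_integral_le_lpNorm {p : ℝ≥0∞} (hp : 1 ≤ p) (φ : C(T, ℂ)) :
    ‖∫ x, φ x ∂arc‖ ≤ lpNorm φ p arc := by
  refine le_trans ?_ (lpNorm_continuousMap_mono_exponent hp φ)
  rw [lpNorm_one_eq_integral_norm φ.continuous.aestronglyMeasurable]
  exact norm_integral_le_integral_norm _

/-- The Riesz projection is contractive in `L^2`, by orthogonality. -/
lemma lpNorm_two_le_of_mem_trigSpan {a b : C(T, ℂ)} (ha : a ∈ trigSpan (Set.Ici 0))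
    (hb : b ∈ trigSpan (Set.Iio 0)) : lpNorm a 2 arc ≤ lpNorm (a + b : C(T, ℂ)) 2 arc := by
  have horth : inner ℂ (ContinuousMap.toLp 2 arc ℂ a) (ContinuousMap.toLp 2 arc ℂ b) = 0 := by
    rw [ContinuousMap.inner_toLp]
    refine integral_eq_zero_of_mem_trigSpan (S := Set.Iio 0) (by simp)
      (a := b * star a) (mul_mem_trigSpan (S := Set.Iio 0) (S' := Set.Iic 0) ?_ hb
        (star_mem_trigSpan ?_ ha))
    · intro m hm n hn; simp only [Set.mem_Iio, Set.mem_Iic] at *; lia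
    · intro m hm; simp only [Set.mem_Ici, Set.mem_Iic] at *; lia
  have h := norm_add_sq_eq_norm_sq_add_norm_sq_of_inner_eq_zero _ _ horth
  rw [← map_add] at h
  simp only [norm_toLp_eq_lpNorm] at h
  refine abs_le_of_sq_le_sq' ?_ lpNorm_nonneg |>.2
  nlinarith [lpNorm_nonneg (f := b) (p := 2) (μ := arc)]

lemma const_mem_trigSpan (c : ℂ) : ContinuousMap.const T c ∈ trigSpan (Set.Ici 0) := by
  have : ContinuousMap.const T c = c • fourier 0 := by ext x; simp
  rw [this]
  exact Submodule.smul_mem _ _ (fourier_mem_trigSpan (by simp))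

lemma exists_decomposition_of_pos {p : ℝ≥0∞} (hp1 : 1 < p) (hp2 : p ≤ 2) :
    ∃ K : ℝ, 0 ≤ K ∧ ∀ g ∈ trigSpan Set.univ, (∀ x, 0 < (g x).re ∧ (g x).im = 0) →
      ∃ a ∈ trigSpan (Set.Ici 0), ∃ b ∈ trigSpan (Set.Iio 0), a + b = g ∧
        lpNorm a p arc ≤ K * lpNorm g p arc := by
  obtain ⟨K, hK, h⟩ := exists_lpNorm_le_lpNorm_re hp1 hp2
  refine ⟨(K + 1) / 2, by positivity, fun g hg hpos ↦ ?_⟩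
  obtain ⟨g₁, hg₁, g₂, hg₂, rfl⟩ := exists_add_of_mem_trigSpan hg
  -- `G` is analytic with real part `g`, and `(G + c) / 2`, with `c` the mean of `g`, is the
  -- analytic part of `g`.
  set g := g₁ + g₂ with hgdef
  set G : C(T, ℂ) := g₁ + star g₂ with hG
  have hstar2 : star g₂ ∈ trigSpan (Set.Ioi 0) :=
    star_mem_trigSpan (fun m hm ↦ by simp only [Set.mem_Iio, Set.mem_Ioi] at *; lia) hg₂
  have hGmem : G ∈ trigSpan (Set.Ici 0) :=
    add_mem hg₁ (trigSpan_mono Set.Ioi_subset_Ici_self hstar2)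
  have hre : ∀ x, (G x).re = (g x).re := fun x ↦ by simp [hG, hgdef]
  have hreal : ∀ x, g x = ((g x).re : ℂ) := fun x ↦ Complex.ext (by simp) (by simp [(hpos x).2])
  set c : ℂ := ∫ x, g x ∂arc with hc
  have hc_real : c = ((∫ x, (g x).re ∂arc : ℝ) : ℂ) := by
    rw [hc, ← integral_complex_ofReal]
    exact integral_congr_ae (.of_forall hreal)
  have hGc : ∫ x, G x ∂arc = c := by
    have h1 : ∫ x, G x ∂arc = ∫ x, g₁ x ∂arc + ∫ x, (star g₂) x ∂arc :=
      integral_add (integrable_continuousMap g₁) (integrable_continuousMap (star g₂))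
    have h2 : c = ∫ x, g₁ x ∂arc + ∫ x, g₂ x ∂arc :=
      integral_add (integrable_continuousMap g₁) (integrable_continuousMap g₂)
    rw [h1, h2, integral_eq_zero_of_mem_trigSpan (by simp) hstar2,
      integral_eq_zero_of_mem_trigSpan (by simp) hg₂]
  have hstarG : star G ∈ trigSpan (Set.Iic 0) :=
    star_mem_trigSpan (fun m hm ↦ by simp only [Set.mem_Ici, Set.mem_Iic] at *; lia) hGmem
  have hstarGc : ∫ x, (star G) x ∂arc = c := by
    have : ∫ x, (star G) x ∂arc = (starRingEnd ℂ) (∫ x, G x ∂arc) := integral_conj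
    rw [this, hGc, hc_real, Complex.conj_ofReal]
  refine ⟨(1 / 2 : ℂ) • (G + ContinuousMap.const T c),
    Submodule.smul_mem _ _ (add_mem hGmem (const_mem_trigSpan c)),
    (1 / 2 : ℂ) • (star G - ContinuousMap.const T c),
    Submodule.smul_mem _ _ (hstarGc ▸ sub_integral_mem_trigSpan hstarG), ?_, ?_⟩
  · ext x
    have h1 : G x + (starRingEnd ℂ) (G x) = 2 * g x := by
      rw [Complex.add_conj, hre, hreal x]; simp
    have h2 : (star G) x = (starRingEnd ℂ) (G x) := rfl
    simp only [ContinuousMap.add_apply, ContinuousMap.smul_apply, ContinuousMap.sub_apply,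
      ContinuousMap.const_apply, smul_eq_mul, h2]
    linear_combination (1 / 2 : ℂ) * h1
  · have hGle : lpNorm G p arc ≤ K * lpNorm g p arc := by
      refine (h G hGmem (fun x ↦ by rw [hre]; exact (hpos x).1) ?_).trans ?_
      · rw [hGc, hc_real, Complex.ofReal_im]
      · gcongr
        refine lpNorm_mono_real (memLp_continuousMap g p).norm (fun x ↦ ?_) |>.trans_eq
          (lpNorm_norm g.continuous.aestronglyMeasurable p)
        rw [hre]
        exact Complex.abs_re_le_norm _
    have hcle : lpNorm (ContinuousMap.const T c) p arc ≤ lpNorm g p arc :=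
      (lpNorm_continuousMap_le_norm hp1.le _).trans
        ((ContinuousMap.norm_le _ (norm_nonneg c)).2 (fun x ↦ le_rfl) |>.trans
          (norm_integral_le_lpNorm hp1.le g))
    rw [lpNorm_continuousMap_smul]
    have := lpNorm_continuousMap_add_le hp1.le G (ContinuousMap.const T c)
    have hhalf : ‖(1 / 2 : ℂ)‖ = 1 / 2 := by norm_num
    rw [hhalf]
    linarith

/-- A nonnegative continuous function is a uniform limit of positive trigonometric polynomials
with controlled analytic parts. -/
lemma exists_approx_of_nonneg {p : ℝ≥0∞} (hp1 : 1 < p) (hp2 : p ≤ 2) :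
    ∃ K : ℝ, 0 ≤ K ∧ ∀ φ : C(T, ℂ), (∀ x, 0 ≤ (φ x).re ∧ (φ x).im = 0) → ∀ ε : ℝ, 0 < ε →
      ∃ a ∈ trigSpan (Set.Ici 0), ∃ b ∈ trigSpan (Set.Iio 0), ‖a + b - φ‖ ≤ ε ∧
        lpNorm a p arc ≤ K * (lpNorm φ p arc + ε) := by
  obtain ⟨K, hK, h⟩ := exists_decomposition_of_pos hp1 hp2
  refine ⟨K, hK, fun φ hφ ε hε ↦ ?_⟩
  obtain ⟨f, hf, hfφ⟩ := Metric.dense_iff.1 dense_trigSpan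
    (φ + ContinuousMap.const T ((ε / 2 : ℝ) : ℂ)) (ε / 2) (by positivity)
  rw [mem_ball_iff_norm] at hf
  set g : C(T, ℂ) := (1 / 2 : ℂ) • (f + star f) with hg
  have hgx : ∀ x, g x = ((f x).re : ℂ) := fun x ↦ by
    have h1 : g x = (1 / 2 : ℂ) * (f x + (starRingEnd ℂ) (f x)) := rfl
    rw [h1, Complex.add_conj]; push_cast; ring
  have hgmem : g ∈ trigSpan Set.univ := Submodule.smul_mem _ _
    (add_mem hfφ (star_mem_trigSpan (S := Set.univ) (by simp) hfφ))
  have hclose : ∀ x, |(f x).re - ((φ x).re + ε / 2)| < ε / 2 := fun x ↦ by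
    refine lt_of_le_of_lt ?_ ((ContinuousMap.norm_coe_le_norm _ x).trans_lt hf)
    refine le_trans (le_of_eq ?_) (Complex.abs_re_le_norm _)
    simp
  have hpos : ∀ x, 0 < (g x).re ∧ (g x).im = 0 := fun x ↦ by
    rw [hgx]
    refine ⟨?_, Complex.ofReal_im _⟩
    rw [Complex.ofReal_re]
    linarith [(abs_lt.1 (hclose x)).1, (hφ x).1]
  have hgφ : ‖g - φ‖ ≤ ε := (ContinuousMap.norm_le _ hε.le).2 fun x ↦ by
    have h1 : (g - φ) x = (((f x).re - (φ x).re : ℝ) : ℂ) := by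
      rw [ContinuousMap.sub_apply, hgx]
      apply Complex.ext <;> simp [(hφ x).2]
    rw [h1, Complex.norm_real, Real.norm_eq_abs, abs_le]
    constructor <;> linarith [(abs_lt.1 (hclose x)).1, (abs_lt.1 (hclose x)).2]
  obtain ⟨a, ha, b, hb, hab, hle⟩ := h g hgmem hpos
  refine ⟨a, ha, b, hb, hab ▸ hgφ, hle.trans ?_⟩
  gcongr
  calc lpNorm g p arc = lpNorm (φ + (g - φ) : C(T, ℂ)) p arc := by rw [add_sub_cancel]
    _ ≤ lpNorm φ p arc + lpNorm (g - φ) p arc := lpNorm_continuousMap_add_le hp1.le _ _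
    _ ≤ lpNorm φ p arc + ε := by
      gcongr
      exact (lpNorm_continuousMap_le_norm hp1.le _).trans hgφ

/-- The Riesz projection, acting on trigonometric polynomials, is bounded in the `L^p` norm. -/
def RieszBound (p : ℝ≥0∞) : Prop :=
  ∃ C : ℝ, 0 ≤ C ∧ ∀ a ∈ trigSpan (Set.Ici 0), ∀ b ∈ trigSpan (Set.Iio 0),
    lpNorm a p arc ≤ C * lpNorm (a + b : C(T, ℂ)) p arc

/-- The positive part of a real continuous function, as a complex function. -/
def posPart (r : C(T, ℝ)) : C(T, ℂ) := ⟨fun x ↦ ((max (r x) 0 : ℝ) : ℂ), by fun_prop⟩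

lemma posPart_nonneg (r : C(T, ℝ)) (x : T) : 0 ≤ (posPart r x).re ∧ (posPart r x).im = 0 :=
  ⟨by simp [posPart], by simp [posPart]⟩

lemma norm_posPart_le (r : C(T, ℝ)) (x : T) : ‖posPart r x‖ ≤ |r x| := by
  simp only [posPart, ContinuousMap.coe_mk, Complex.norm_real, Real.norm_eq_abs]
  rw [abs_of_nonneg (le_max_right _ _)]
  exact max_le (le_abs_self _) (abs_nonneg _)

lemma posPart_sub_posPart_neg (r : C(T, ℝ)) (x : T) : posPart r x - posPart (-r) x = r x := by
  simp only [posPart, ContinuousMap.coe_mk, ContinuousMap.neg_apply]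
  rw [← Complex.ofReal_sub]
  congr 1
  rcases le_total (r x) 0 with h | h <;> simp [h]

lemma rieszBound_of_le_two {p : ℝ≥0∞} (hp1 : 1 < p) (hp2 : p ≤ 2) : RieszBound p := by
  obtain ⟨K, hK, h⟩ := exists_approx_of_nonneg hp1 hp2
  refine ⟨4 * K, by positivity, fun a ha b hb ↦ ?_⟩
  set f := a + b with hf
  let re : C(T, ℝ) := ⟨fun x ↦ (f x).re, Complex.continuous_re.comp f.continuous⟩
  let im : C(T, ℝ) := ⟨fun x ↦ (f x).im, Complex.continuous_im.comp f.continuous⟩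
  have hle : ∀ r : C(T, ℝ), (∀ x, |r x| ≤ ‖f x‖) → lpNorm (posPart r) p arc ≤ lpNorm f p arc :=
    fun r hr ↦ lpNorm_continuousMap_mono (memLp_continuousMap f p)
      fun x ↦ (norm_posPart_le r x).trans (hr x)
  have hsum : f = posPart re - posPart (-re)
      + Complex.I • (posPart im - posPart (-im)) := by
    ext x
    simp only [ContinuousMap.add_apply, ContinuousMap.sub_apply, ContinuousMap.smul_apply,
      posPart_sub_posPart_neg, smul_eq_mul]
    exact (Complex.re_add_im (f x)).symm.trans (congrArg _ (mul_comm _ _))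
  have key : ∀ ε : ℝ, 0 < ε →
      lpNorm a p arc ≤ 4 * K * lpNorm f p arc + ε * (4 + 4 * K) := fun ε hε ↦ by
    have hA : ∀ r : C(T, ℝ), (∀ x, |r x| ≤ ‖f x‖) → ∃ a ∈ trigSpan (Set.Ici 0),
        ∃ b ∈ trigSpan (Set.Iio 0), ‖a + b - posPart r‖ ≤ ε ∧
        lpNorm a p arc ≤ K * (lpNorm f p arc + ε) := fun r hr ↦ by
      obtain ⟨a, ha, b, hb, h1, h2⟩ := h (posPart r) (posPart_nonneg r) ε hε
      exact ⟨a, ha, b, hb, h1, h2.trans (by gcongr; exact hle r hr)⟩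
    obtain ⟨a₀, ha₀, b₀, hb₀, hn₀, hl₀⟩ := hA re fun x ↦ Complex.abs_re_le_norm (f x)
    obtain ⟨a₁, ha₁, b₁, hb₁, hn₁, hl₁⟩ := hA (-re) fun x ↦ by
      simpa using! Complex.abs_re_le_norm (f x)
    obtain ⟨a₂, ha₂, b₂, hb₂, hn₂, hl₂⟩ := hA im fun x ↦ Complex.abs_im_le_norm (f x)
    obtain ⟨a₃, ha₃, b₃, hb₃, hn₃, hl₃⟩ := hA (-im) fun x ↦ by
      simpa using! Complex.abs_im_le_norm (f x)
    set a' := a₀ - a₁ + Complex.I • (a₂ - a₃) with ha'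
    set b' := b₀ - b₁ + Complex.I • (b₂ - b₃) with hb'
    have ha'mem : a' ∈ trigSpan (Set.Ici 0) :=
      add_mem (sub_mem ha₀ ha₁) (Submodule.smul_mem _ _ (sub_mem ha₂ ha₃))
    have hb'mem : b' ∈ trigSpan (Set.Iio 0) :=
      add_mem (sub_mem hb₀ hb₁) (Submodule.smul_mem _ _ (sub_mem hb₂ hb₃))
    -- The error is small uniformly, hence in `L^2`, hence so is its analytic part in `L^p`.
    have herr : ‖(a - a') + (b - b')‖ ≤ 4 * ε := by
      have h1 : (a - a') + (b - b') =
          -(((a₀ + b₀ - posPart re) - (a₁ + b₁ - posPart (-re)))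
          + Complex.I • ((a₂ + b₂ - posPart im) - (a₃ + b₃ - posPart (-im)))) := by
        have h2 : (a - a') + (b - b') = f - (a' + b') := by rw [hf]; abel
        rw [h2, hsum, ha', hb']
        simp only [smul_sub, smul_add]
        abel
      rw [h1, norm_neg]
      refine (norm_add_le _ _).trans ?_
      rw [norm_smul, Complex.norm_I, one_mul]
      have h3 := norm_sub_le (a₀ + b₀ - posPart re) (a₁ + b₁ - posPart (-re))
      have h4 := norm_sub_le (a₂ + b₂ - posPart im) (a₃ + b₃ - posPart (-im))
      linarith
    have hdiff : lpNorm (a - a') p arc ≤ 4 * ε :=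
      (lpNorm_continuousMap_mono_exponent hp2 (a - a')).trans <|
        (lpNorm_two_le_of_mem_trigSpan (sub_mem ha ha'mem) (sub_mem hb hb'mem)).trans <|
        (lpNorm_continuousMap_le_norm (by simp) _).trans herr
    have hsub : ∀ φ ψ : C(T, ℂ), lpNorm (φ - ψ : C(T, ℂ)) p arc ≤
        lpNorm φ p arc + lpNorm ψ p arc := fun φ ψ ↦
      lpNorm_sub_le (memLp_continuousMap φ p) hp1.le
    have ha'le : lpNorm a' p arc ≤ 4 * (K * (lpNorm f p arc + ε)) := by
      refine (lpNorm_continuousMap_add_le hp1.le _ _).trans ?_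
      rw [lpNorm_continuousMap_smul, Complex.norm_I, one_mul]
      linarith [hsub a₀ a₁, hsub a₂ a₃]
    have h5 := lpNorm_continuousMap_add_le hp1.le a' (a - a')
    rw [add_sub_cancel] at h5
    linarith
  refine le_of_forall_pos_le_add fun δ hδ ↦ ?_
  refine (key (δ / (4 + 4 * K)) (by positivity)).trans_eq ?_
  field_simp

/-- If the Riesz projection is bounded in `L^p`, it is bounded in `L^{2p}`: for `f = a + b` with
analytic part `a`, the function `a²` is the analytic part of `a² - b² = (a + b) (a - b)`. -/
lemma RieszBound.doubling {p : ℝ≥0∞} (hp : 1 ≤ p) (h : RieszBound p) :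
    RieszBound (2 * p) := by
  obtain ⟨C, hC, h⟩ := h
  have hp2 : 1 ≤ 2 * p := hp.trans (by rw [two_mul]; exact le_self_add)
  have hH : ENNReal.HolderTriple (2 * p) (2 * p) p := ⟨by
    rw [ENNReal.mul_inv (.inl (by simp)) (.inl (by simp)), ← add_mul, ENNReal.inv_two_add_inv_two,
      one_mul]⟩
  have hmul : ∀ φ ψ : C(T, ℂ), lpNorm (φ * ψ : C(T, ℂ)) p arc ≤
      lpNorm φ (2 * p) arc * lpNorm ψ (2 * p) arc := fun φ ψ ↦ by
    rw [← toReal_eLpNorm (by fun_prop), ← toReal_eLpNorm (by fun_prop),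
      ← toReal_eLpNorm (by fun_prop), ← ENNReal.toReal_mul]
    exact ENNReal.toReal_mono (ENNReal.mul_ne_top (memLp_continuousMap φ _).2.ne
      (memLp_continuousMap ψ _).2.ne) (eLpNorm_smul_le_mul_eLpNorm (φ := φ) (f := ψ)
        (by fun_prop) (by fun_prop))
  have hsq : ∀ φ : C(T, ℂ), lpNorm (φ * φ : C(T, ℂ)) p arc = lpNorm φ (2 * p) arc ^ 2 := fun φ ↦ by
    rw [← toReal_eLpNorm (by fun_prop), ← toReal_eLpNorm (by fun_prop), ← ENNReal.toReal_pow]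
    congr 1
    have := eLpNorm_norm_rpow (p := p) (μ := arc) φ (q := 2) (by norm_num)
    rw [ENNReal.ofReal_ofNat, mul_comm p, ENNReal.rpow_ofNat] at this
    rw [← this, ← eLpNorm_norm]
    congr 1
    ext x
    simp [pow_two]
  refine ⟨2 * C + 1, by positivity, fun a ha b hb ↦ ?_⟩
  have h1 := h (a * a) (mul_mem_trigSpan (S := Set.Ici 0) (S' := Set.Ici 0)
      (fun m hm n hn ↦ by simp only [Set.mem_Ici] at *; lia) ha ha)
    (-(b * b)) (neg_mem (mul_mem_trigSpan (S := Set.Iio 0) (S' := Set.Iio 0)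
      (fun m hm n hn ↦ by simp only [Set.mem_Iio] at *; lia) hb hb))
  have h2 : a * a + -(b * b) = (a + b) * (a - b) := by ring
  have h3 : a - b = (2 : ℂ) • a + (-1 : ℂ) • (a + b) := by
    rw [two_smul, neg_one_smul]; abel
  have h4 := lpNorm_continuousMap_add_le hp2 ((2 : ℂ) • a) ((-1 : ℂ) • (a + b))
  rw [← h3, lpNorm_continuousMap_smul, lpNorm_continuousMap_smul] at h4
  rw [h2, hsq] at h1
  have h5 := hmul (a + b) (a - b)
  norm_num at h4
  set x := lpNorm a (2 * p) arc
  set y := lpNorm (a + b : C(T, ℂ)) (2 * p) arc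
  have hx : 0 ≤ x := lpNorm_nonneg
  have hy : 0 ≤ y := lpNorm_nonneg
  have h6 : x ^ 2 ≤ C * (y * (2 * x + y)) :=
    h1.trans (mul_le_mul_of_nonneg_left (h5.trans (mul_le_mul_of_nonneg_left h4 hy)) hC)
  by_contra! hlt
  nlinarith [mul_nonneg hC hy, mul_nonneg hC hx, mul_nonneg hx hy]

/-- M. Riesz's theorem on trigonometric polynomials. -/
theorem rieszBound {p : ℝ≥0∞} (hp1 : 1 < p) (hp2 : p < ∞) : RieszBound p := by
  obtain ⟨n, hn⟩ : ∃ n : ℕ, p ≤ 2 ^ n := by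
    obtain ⟨n, hn⟩ := ENNReal.exists_nat_gt hp2.ne
    exact ⟨n, hn.le.trans (by exact_mod_cast Nat.lt_two_pow_self.le)⟩
  induction n generalizing p with
  | zero => exact absurd hp1 (by simpa using hn)
  | succ n ih =>
    rcases le_or_gt p 2 with h | h
    · exact rieszBound_of_le_two hp1 h
    · have h1 : 1 < p / 2 := by
        rw [ENNReal.lt_div_iff_mul_lt (by simp) (by simp), one_mul]; exact h
      have h2 : p / 2 < ∞ := ENNReal.div_lt_top hp2.ne (by simp)
      have h3 : p / 2 ≤ 2 ^ n := ENNReal.div_le_of_le_mul (by rwa [← pow_succ])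
      have := (ih h1 h2 h3).doubling h1.le
      rwa [ENNReal.mul_div_cancel (by simp) (by simp)] at this

/-! ### The Riesz projection -/

section Riesz

variable {p : ℝ≥0∞} [Fact (1 ≤ p)]

/-- The Riesz projection exists as a bounded operator: extend it by continuity from
trigonometric polynomials. -/
theorem exists_riesz (hp₁ : 1 < p) (hp₂ : p < ∞) :
    ∃ P : LpT p →L[ℂ] Hardy p,
      ∀ (f : LpT p) (n : ℤ), 0 ≤ n → fourierCoeff (P f : LpT p) n = fourierCoeff f n := by
  obtain ⟨C, -, hC⟩ := rieszBound hp₁ hp₂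
  let L := ContinuousMap.toLp (E := ℂ) p arc ℂ
  let e : (trigSpan (Set.Ici 0) × trigSpan (Set.Iio 0)) →ₗ[ℂ] LpT p :=
    L.toLinearMap ∘ₗ (trigSpan (Set.Ici 0)).subtype.coprod (trigSpan (Set.Iio 0)).subtype
  let π : (trigSpan (Set.Ici 0) × trigSpan (Set.Iio 0)) →ₗ[ℂ] LpT p :=
    L.toLinearMap ∘ₗ (trigSpan (Set.Ici 0)).subtype ∘ₗ LinearMap.fst ℂ _ _
  have he : ∀ x, e x = L (x.1 + x.2) := fun x ↦ rfl
  have hπ : ∀ x, π x = L x.1 := fun x ↦ rfl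
  have hdense : DenseRange e := by
    have h1 : Dense (L '' (trigSpan Set.univ : Set C(T, ℂ))) :=
      (ContinuousMap.toLp_denseRange ℂ arc ℂ hp₂.ne).dense_image L.continuous dense_trigSpan
    refine h1.mono ?_
    rintro _ ⟨f, hf, rfl⟩
    obtain ⟨a, ha, b, hb, rfl⟩ := exists_add_of_mem_trigSpan hf
    exact ⟨(⟨a, ha⟩, ⟨b, hb⟩), rfl⟩
  have hnorm : ∀ x, ‖π x‖ ≤ C * ‖e x‖ := fun x ↦ by
    rw [he, hπ, norm_toLp_eq_lpNorm, norm_toLp_eq_lpNorm]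
    exact hC _ x.1.2 _ x.2.2
  have hzero : ∀ {S : Set ℤ} {a : C(T, ℂ)}, a ∈ trigSpan S → ∀ n ∉ S, coeff p n (L a) = 0 := by
    intro S a ha n hn
    have : trigSpan S ≤ LinearMap.ker ((coeff p n).toLinearMap ∘ₗ L.toLinearMap) := by
      rw [trigSpan, Submodule.span_le]
      rintro _ ⟨m, hm, rfl⟩
      change coeff p n (fourierLp p m) = 0
      rw [coeff_fourierLp, if_neg (by rintro rfl; exact hn hm)]
    exact this ha
  let P : LpT p →L[ℂ] LpT p := π.extendOfNorm e
  have hP : ∀ x, P (e x) = π x := LinearMap.extendOfNorm_eq hdense ⟨C, hnorm⟩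
  have hmem : ∀ f, P f ∈ Hardy p := fun f ↦ by
    induction f using hdense.induction_on with
    | hp => exact isClosed_hardy.preimage P.continuous
    | ih x =>
      rw [hP, hπ, mem_hardy_iff]
      exact fun n hn ↦ hzero x.1.2 n (by simpa using hn)
  refine ⟨P.codRestrict (Hardy p) hmem, fun f n hn ↦ ?_⟩
  change coeff p n (P f) = coeff p n f
  induction f using hdense.induction_on with
  | hp => exact isClosed_eq ((coeff p n).continuous.comp P.continuous) (coeff p n).continuous
  | ih x => rw [hP, hπ, he, map_add, map_add, hzero x.2.2 n (by simpa using hn), add_zero]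

lemma coeff_riesz (hp₁ : 1 < p) (hp₂ : p < ∞) (f : LpT p) {n : ℤ} (hn : 0 ≤ n) :
    coeff p n (riesz p f : LpT p) = coeff p n f := by
  have h := exists_riesz hp₁ hp₂
  rw [riesz, dif_pos h]
  exact h.choose_spec f n hn

lemma riesz_hardy (hp₁ : 1 < p) (hp₂ : p < ∞) (f : Hardy p) : riesz p (f : LpT p) = f :=
  ext_coeff_hardy fun _ hn ↦ coeff_riesz hp₁ hp₂ _ hn

end Riesz

/-! ### Algebra of Toeplitz operators -/

section Toeplitz

variable {p : ℝ≥0∞} [Fact (1 ≤ p)]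

lemma toeplitz_apply (u : Symb) (f : Hardy p) : toeplitz p u f = riesz p (mulOp p u f) := rfl

lemma toeplitz_neg (u : Symb) : toeplitz p (-u) = -toeplitz p u := by
  ext1 f
  rw [toeplitz_apply, mulOp_neg, neg_apply, map_neg]
  rfl

lemma coeff_toeplitz_tPow (hp₁ : 1 < p) (hp₂ : p < ∞) (k : ℤ) (f : Hardy p) {n : ℤ}
    (hn : 0 ≤ n) : coeff p n (toeplitz p (tPow k) f : LpT p) = coeff p (n - k) (f : LpT p) := by
  rw [toeplitz_apply, coeff_riesz hp₁ hp₂ _ hn, coeff_mulOp_tPow]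

lemma coe_toeplitz_tPow_of_nonneg (hp₁ : 1 < p) (hp₂ : p < ∞) {k : ℤ} (hk : 0 ≤ k)
    (f : Hardy p) : (toeplitz p (tPow k) f : LpT p) = mulOp p (tPow k) f := by
  have h : mulOp p (tPow k) f ∈ Hardy p := (mem_hardy_iff _).2 fun n hn ↦ by
    rw [coeff_mulOp_tPow, coeff_hardy_of_neg f (by lia)]
  rw [toeplitz_apply]
  exact congrArg Subtype.val (riesz_hardy hp₁ hp₂ ⟨_, h⟩)

lemma toeplitz_symbMul_tPow_of_nonneg (hp₁ : 1 < p) (hp₂ : p < ∞) (u : Symb) {k : ℤ}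
    (hk : 0 ≤ k) : toeplitz p (symbMul u (tPow k)) = toeplitz p u ∘L toeplitz p (tPow k) := by
  ext1 f
  rw [ContinuousLinearMap.comp_apply, toeplitz_apply u,
    coe_toeplitz_tPow_of_nonneg hp₁ hp₂ hk, toeplitz_apply, mulOp_symbMul]

lemma toeplitz_symbMul_tPow_of_nonpos (hp₁ : 1 < p) (hp₂ : p < ∞) (u : Symb) {k : ℤ}
    (hk : k ≤ 0) : toeplitz p (symbMul u (tPow k)) = toeplitz p (tPow k) ∘L toeplitz p u := by
  ext1 f
  refine ext_coeff_hardy fun n hn ↦ ?_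
  rw [ContinuousLinearMap.comp_apply, coeff_toeplitz_tPow hp₁ hp₂ _ _ hn, toeplitz_apply,
    toeplitz_apply, coeff_riesz hp₁ hp₂ _ hn, coeff_riesz hp₁ hp₂ _ (by lia), mulOp_symbMul,
    mulOp_mulOp_comm, coeff_mulOp_tPow]

lemma symbMul_symbMul_tPow_neg (u : Symb) (k : ℤ) :
    symbMul (symbMul u (tPow k)) (tPow (-k)) = u := by
  refine Lp.ext ?_
  have hmul : ∀ u v : Symb, symbMul u v =ᵐ[arc] fun x ↦ u x * v x := fun u v ↦
    (ContinuousLinearMap.mul ℂ ℂ).coeFn_holder u v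
  have htPow : ∀ k, tPow k =ᵐ[arc] fourier k := fun k ↦ coeFn_fourierLp ∞ k
  filter_upwards [hmul (symbMul u (tPow k)) (tPow (-k)), hmul u (tPow k), htPow k,
    htPow (-k)] with x h1 h2 h3 h4
  rw [h1, h2, h3, h4, mul_assoc, ← fourier_add, add_neg_cancel, fourier_zero, mul_one]

lemma toeplitz_tPow_neg_toeplitz_tPow (hp₁ : 1 < p) (hp₂ : p < ∞) {k : ℤ} (hk : 0 ≤ k)
    (f : Hardy p) : toeplitz p (tPow (-k)) (toeplitz p (tPow k) f) = f := by
  refine ext_coeff_hardy fun n hn ↦ ?_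
  rw [coeff_toeplitz_tPow hp₁ hp₂ _ _ hn, coeff_toeplitz_tPow hp₁ hp₂ _ _ (by lia)]
  congr 2; lia

/-- The monomial `t ^ n`, `n ≥ 0`, as an element of the Hardy space. -/
def monomial (p : ℝ≥0∞) [Fact (1 ≤ p)] (n : ℕ) : Hardy p :=
  ⟨fourierLp p n, (mem_hardy_iff _).2 fun m hm ↦ by
    rw [coeff_fourierLp, if_neg (by lia)]⟩

lemma coeff_monomial (n : ℕ) (m : ℤ) :
    coeff p m (monomial p n : LpT p) = if m = n then 1 else 0 := coeff_fourierLp _ _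

lemma coeff_sum_monomial (c : ℕ → ℂ) (k : ℕ) (n : ℕ) :
    coeff p n ((∑ i ∈ Finset.range k, c i • monomial p i : Hardy p) : LpT p) =
      if n < k then c n else 0 := by
  rw [Submodule.coe_sum, map_sum]
  simp [coeff_monomial]

/-- An element of the Hardy space whose coefficients of index at least `k` vanish is a
polynomial. -/
lemma eq_sum_monomial (f : Hardy p) (k : ℕ)
    (hf : ∀ n : ℕ, k ≤ n → coeff p n (f : LpT p) = 0) :
    f = ∑ i ∈ Finset.range k, coeff p i (f : LpT p) • monomial p i := by
  refine ext_coeff_hardy fun n hn ↦ ?_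
  lift n to ℕ using hn
  rw [coeff_sum_monomial (fun i ↦ coeff p i (f : LpT p))]
  split_ifs with h
  · rfl
  · exact hf n (by lia)

lemma toeplitz_tPow_neg_eq_zero_iff (hp₁ : 1 < p) (hp₂ : p < ∞) (k : ℕ) (f : Hardy p) :
    toeplitz p (tPow (-k)) f = 0 ↔ ∀ n : ℕ, k ≤ n → coeff p n (f : LpT p) = 0 := by
  constructor
  · intro h n hn
    have h1 := coeff_toeplitz_tPow hp₁ hp₂ (-k) f (n := n - k) (by lia)
    rw [h, ZeroMemClass.coe_zero, map_zero] at h1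
    rw [h1]
    congr 2; lia
  · intro h
    refine ext_coeff_hardy fun n hn ↦ ?_
    lift n to ℕ using hn
    rw [coeff_toeplitz_tPow hp₁ hp₂ _ _ (by lia), ZeroMemClass.coe_zero, map_zero]
    have := h (n + k) (by lia)
    push_cast at this
    rwa [sub_neg_eq_add]

/-- The kernel of `T(t^{-k})` consists of the polynomials of degree less than `k`. -/
lemma nonempty_ker_toeplitz_tPow_neg_equiv (hp₁ : 1 < p) (hp₂ : p < ∞) (k : ℕ) :
    Nonempty ((toeplitz p (tPow (-k))).ker ≃ₗ[ℂ] (Fin k → ℂ)) := by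
  let Φ : (toeplitz p (tPow (-k))).ker →ₗ[ℂ] (Fin k → ℂ) :=
    LinearMap.pi fun i ↦ (coeff p (i : ℕ)).toLinearMap ∘ₗ (Hardy p).subtype ∘ₗ Submodule.subtype _
  have hΦ : ∀ f i, Φ f i = coeff p (i : ℕ) ((f : Hardy p) : LpT p) := fun f i ↦ rfl
  have hbij : Function.Bijective Φ := by
    constructor
    · rw [← LinearMap.ker_eq_bot, LinearMap.ker_eq_bot']
      intro f hf
      refine Subtype.ext ?_
      rw [eq_sum_monomial (f : Hardy p) k
        ((toeplitz_tPow_neg_eq_zero_iff hp₁ hp₂ k _).1 f.2)]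
      refine Finset.sum_eq_zero fun i hi ↦ ?_
      have := congrFun hf ⟨i, Finset.mem_range.1 hi⟩
      rw [hΦ] at this
      rw [this]
      exact zero_smul _ _
    · intro c
      let c' : ℕ → ℂ := fun i ↦ if h : i < k then c ⟨i, h⟩ else 0
      refine ⟨⟨∑ i ∈ Finset.range k, c' i • monomial p i,
        (toeplitz_tPow_neg_eq_zero_iff hp₁ hp₂ k _).2 fun n hn ↦ ?_⟩, ?_⟩
      · rw [coeff_sum_monomial, if_neg (by lia)]
      · ext i
        rw [hΦ, coeff_sum_monomial, if_pos i.2]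
        simp [c']
  exact ⟨.ofBijective Φ hbij⟩

end Toeplitz

/-! ### Fredholm operators: composition, products and index -/

section Fredholm

variable {E F G : Type*} [NormedAddCommGroup E] [NormedSpace ℂ E] [NormedAddCommGroup F]
  [NormedSpace ℂ F] [NormedAddCommGroup G] [NormedSpace ℂ G]

open scoped LinearMap.FiniteRangeSetoid
open LinearMap.FiniteRangeSetoid

lemma isFredholm_comp {S : F →L[ℂ] G} {R : E →L[ℂ] F} (hS : S.IsFredholm) (hR : R.IsFredholm) :
    (S ∘L R).IsFredholm := by
  obtain ⟨S', hS'⟩ := hS.exists_isQuasiInverse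
  obtain ⟨R', hR'⟩ := hR.exists_isQuasiInverse
  exact .of_isQuasiInverse (v := R' ∘L S') (hR'.comp hS')

lemma isFredholm_of_comp_left {S : F →L[ℂ] G} {R : E →L[ℂ] F} (hSR : (S ∘L R).IsFredholm)
    (hR : R.IsFredholm) : S.IsFredholm := by
  obtain ⟨Q, hQ⟩ := hSR.exists_isQuasiInverse
  obtain ⟨R', hR'⟩ := hR.exists_isQuasiInverse
  exact .of_isQuasiInverse (v := R ∘L Q) (LinearMap.IsQuasiInverse.of_comp_left hR' hQ)

lemma isFredholm_of_comp_right {S : F →L[ℂ] G} {R : E →L[ℂ] F} (hSR : (S ∘L R).IsFredholm)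
    (hS : S.IsFredholm) : R.IsFredholm := by
  obtain ⟨Q, hQ⟩ := hSR.exists_isQuasiInverse
  obtain ⟨S', hS'⟩ := hS.exists_isQuasiInverse
  exact .of_isQuasiInverse (v := Q ∘L S) (LinearMap.IsQuasiInverse.of_comp_right hS' hQ)

lemma isFredholm_of_equiv (e : E ≃L[ℂ] F) : (e : E →L[ℂ] F).IsFredholm :=
  .of_isQuasiInverse (v := (e.symm : F →L[ℂ] E)) e.toLinearEquiv.isQuasiInverse

lemma isFredholm_prodMap {A : E →L[ℂ] E} {B : F →L[ℂ] F} (hA : A.IsFredholm)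
    (hB : B.IsFredholm) : (A.prodMap B).IsFredholm := by
  obtain ⟨A', hA'⟩ := hA.exists_isQuasiInverse
  obtain ⟨B', hB'⟩ := hB.exists_isQuasiInverse
  have key : ∀ {f : E →ₗ[ℂ] E} {g : F →ₗ[ℂ] F}, f ≈ .id → g ≈ .id → f.prodMap g ≈ .id := by
    intro f g hf hg
    rw [equiv_iff_hasNoetherianRange] at *
    have h := ((hf.comp_right (LinearMap.fst ℂ E F)).comp_left (LinearMap.inl ℂ E F)).add
      ((hg.comp_right (LinearMap.snd ℂ E F)).comp_left (LinearMap.inr ℂ E F))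
    refine (congrArg LinearMap.HasNoetherianRange (LinearMap.ext fun x ↦ ?_)).mp h
    simp [Prod.ext_iff]
  exact .of_isQuasiInverse (v := A'.prodMap B') ⟨key hA'.1 hB'.1, key hA'.2 hB'.2⟩

lemma isFredholm_fst_of_prodMap {A : E →L[ℂ] E} {B : F →L[ℂ] F}
    (h : (A.prodMap B).IsFredholm) : A.IsFredholm := by
  obtain ⟨Q, hQ⟩ := h.exists_isQuasiInverse
  refine .of_isQuasiInverse (v := .fst ℂ E F ∘L Q ∘L .inl ℂ E F) ⟨?_, ?_⟩
  · have h1 := equiv_iff_hasNoetherianRange.1 hQ.1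
    refine equiv_iff_hasNoetherianRange.2 ?_
    refine (congrArg LinearMap.HasNoetherianRange (LinearMap.ext fun x ↦ ?_)).mp
      ((h1.comp_right (LinearMap.inl ℂ E F)).comp_left (LinearMap.fst ℂ E F))
    simp
  · have h1 := equiv_iff_hasNoetherianRange.1 hQ.2
    refine equiv_iff_hasNoetherianRange.2 ?_
    refine (congrArg LinearMap.HasNoetherianRange (LinearMap.ext fun x ↦ ?_)).mp
      ((h1.comp_right (LinearMap.inl ℂ E F)).comp_left (LinearMap.fst ℂ E F))
    simp

lemma isFredholm_id : (ContinuousLinearMap.id ℂ E).IsFredholm :=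
  isFredholm_of_equiv (.refl ℂ E)

lemma index_comp_of_isFredholm {S : F →L[ℂ] G} {R : E →L[ℂ] F} (hS : S.IsFredholm)
    (hR : R.IsFredholm) :
    (S ∘L R).toLinearMap.index = S.toLinearMap.index + R.toLinearMap.index := by
  have := hS.finite_ker
  have := hS.finite_coker
  have := hR.finite_ker
  have := hR.finite_coker
  exact LinearMap.index_comp (f := R.toLinearMap) S.toLinearMap

lemma index_prodMap_of_isFredholm {A : E →L[ℂ] E} {B : F →L[ℂ] F} (hA : A.IsFredholm)
    (hB : B.IsFredholm) :
    (A.prodMap B).toLinearMap.index = A.toLinearMap.index + B.toLinearMap.index := by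
  have := hA.finite_ker
  have := hA.finite_coker
  have := hB.finite_ker
  have := hB.finite_coker
  have hker : Module.finrank ℂ (A.prodMap B).toLinearMap.ker =
      Module.finrank ℂ A.toLinearMap.ker + Module.finrank ℂ B.toLinearMap.ker := by
    rw [← Module.finrank_prod]
    have h1 : (A.prodMap B).toLinearMap.ker =
        (A.toLinearMap.ker.subtype.prodMap B.toLinearMap.ker.subtype).range := by
      rw [LinearMap.range_prodMap, Submodule.range_subtype, Submodule.range_subtype]
      exact LinearMap.ker_prodMap _ _
    rw [h1]
    exact LinearMap.finrank_range_of_inj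
      ((Submodule.subtype_injective _).prodMap (Submodule.subtype_injective _))
  have hcoker : Module.finrank ℂ ((E × F) ⧸ (A.prodMap B).toLinearMap.range) =
      Module.finrank ℂ (E ⧸ A.toLinearMap.range) + Module.finrank ℂ (F ⧸ B.toLinearMap.range) := by
    rw [← Module.finrank_prod]
    let Q := A.toLinearMap.range.mkQ.prodMap B.toLinearMap.range.mkQ
    have h1 : (A.prodMap B).toLinearMap.range = Q.ker := by
      rw [LinearMap.ker_prodMap, Submodule.ker_mkQ, Submodule.ker_mkQ]
      exact LinearMap.range_prodMap _ _
    rw [h1]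
    exact (Q.quotKerEquivOfSurjective (Function.Surjective.prodMap
      (Submodule.mkQ_surjective _) (Submodule.mkQ_surjective _))).finrank_eq
  rw [LinearMap.index_eq_finrank_sub, hker, hcoker, LinearMap.index_eq_finrank_sub,
    LinearMap.index_eq_finrank_sub]
  push_cast
  ring

lemma surjective_of_injective_of_index_nonneg {A : E →L[ℂ] E} (hA : A.IsFredholm)
    (hinj : Function.Injective A) (hind : 0 ≤ A.toLinearMap.index) : Function.Surjective A := by
  have := hA.finite_coker
  have h1 := LinearMap.index_of_injective (f := A.toLinearMap) hinj
  have h2 : Module.finrank ℂ (E ⧸ A.toLinearMap.range) = 0 := by lia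
  have h3 := Module.finrank_zero_iff.1 h2
  exact LinearMap.range_eq_top.1 (Submodule.Quotient.subsingleton_iff.1 h3)

lemma injective_of_surjective_of_index_nonpos {A : E →L[ℂ] E} (hA : A.IsFredholm)
    (hsurj : Function.Surjective A) (hind : A.toLinearMap.index ≤ 0) : Function.Injective A := by
  have := hA.finite_ker
  have h1 := LinearMap.index_of_surjective (f := A.toLinearMap) hsurj
  have h2 : Module.finrank ℂ A.toLinearMap.ker = 0 := by lia
  exact LinearMap.ker_eq_bot.1 (Submodule.finrank_eq_zero.1 h2)

/-- The range of a Fredholm operator is closed, so that a nonzero bounded functional annihilates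
it if it is not the whole space. -/
lemma exists_functional_of_not_surjective {A : E →L[ℂ] F} (hA : A.IsFredholm)
    (hsurj : ¬ Function.Surjective A) : ∃ φ : F →L[ℂ] ℂ, φ ≠ 0 ∧ ∀ x, φ (A x) = 0 := by
  have hclosed : IsClosed (A.toLinearMap.range : Set F) := hA.isClosed_range
  obtain ⟨y, hy⟩ := not_forall.1 hsurj
  have hy' : A.toLinearMap.range.mkQ y ≠ 0 := by
    rw [Submodule.mkQ_apply, Ne, Submodule.Quotient.mk_eq_zero]
    exact hy
  obtain ⟨ψ, hψ⟩ := SeparatingDual.exists_ne_zero (R := ℂ) hy'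
  refine ⟨ψ ∘L A.toLinearMap.range.mkQL, fun h ↦ hψ (DFunLike.congr_fun h y), fun x ↦ ?_⟩
  have : A.toLinearMap.range.mkQ (A x) = 0 := by
    rw [Submodule.mkQ_apply, Submodule.Quotient.mk_eq_zero]
    exact ⟨x, rfl⟩
  change ψ (A.toLinearMap.range.mkQ (A x)) = 0
  rw [this, map_zero]

lemma isInvertible_of_bijective [CompleteSpace E] [CompleteSpace F] {A : E →L[ℂ] F}
    (h : Function.Bijective A) : A.IsInvertible :=
  ⟨ContinuousLinearEquiv.ofBijective A (LinearMap.ker_eq_bot.2 h.1) (LinearMap.range_eq_top.2 h.2),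
    rfl⟩

end Fredholm

/-! ### Operators of the form `(f, g) ↦ (-B g, A f + W g)` -/

section Block

variable {E : Type} [NormedAddCommGroup E] [NormedSpace ℂ E]

/-- The operator on `E × E` given by the matrix with rows `(0, -B)` and `(A, W)`. -/
def blockOp (A B W : E →L[ℂ] E) : E × E →L[ℂ] E × E :=
  (-(B ∘L .snd ℂ E E)).prod (A ∘L .fst ℂ E E + W ∘L .snd ℂ E E)

variable (A B W : E →L[ℂ] E)

lemma blockOp_apply (x : E × E) : blockOp A B W x = (-B x.2, A x.1 + W x.2) := rfl

/-- The invertible operator `(y, g) ↦ (-g, y + W g)`. -/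
def shearSwap : (E × E) ≃L[ℂ] E × E :=
  .equivOfInverse
    ((-(ContinuousLinearMap.snd ℂ E E)).prod (.fst ℂ E E + W ∘L .snd ℂ E E))
    ((ContinuousLinearMap.snd ℂ E E + W ∘L .fst ℂ E E).prod (-(.fst ℂ E E)))
    (fun x ↦ by simp) (fun x ↦ by simp)

/-- The block operator is a product of the diagonal operators `diag(A, 1)` and `diag(B, 1)` with
an invertible operator between them. -/
lemma blockOp_eq_comp : blockOp A B W =
    B.prodMap (.id ℂ E) ∘L (shearSwap W : E × E →L[ℂ] E × E) ∘L A.prodMap (.id ℂ E) := by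
  refine ContinuousLinearMap.ext fun x ↦ ?_
  change (-B x.2, A x.1 + W x.2) = (B (-x.2), A x.1 + W x.2)
  rw [map_neg]

variable {A B}

lemma isFredholm_blockOp (hA : A.IsFredholm) (hB : B.IsFredholm) :
    (blockOp A B W).IsFredholm := by
  rw [blockOp_eq_comp]
  exact isFredholm_comp (isFredholm_prodMap hB isFredholm_id)
    (isFredholm_comp (isFredholm_of_equiv _) (isFredholm_prodMap hA isFredholm_id))

lemma isFredholm_right_of_blockOp (h : (blockOp A B W).IsFredholm) (hA : A.IsFredholm) :
    B.IsFredholm := by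
  rw [blockOp_eq_comp] at h
  exact isFredholm_fst_of_prodMap (isFredholm_of_comp_left h
    (isFredholm_comp (isFredholm_of_equiv _) (isFredholm_prodMap hA isFredholm_id)))

lemma isFredholm_left_of_blockOp (h : (blockOp A B W).IsFredholm) (hB : B.IsFredholm) :
    A.IsFredholm := by
  rw [blockOp_eq_comp] at h
  exact isFredholm_fst_of_prodMap (isFredholm_of_comp_right (isFredholm_of_comp_right h
    (isFredholm_prodMap hB isFredholm_id)) (isFredholm_of_equiv _))

lemma ind_blockOp (hA : A.IsFredholm) (hB : B.IsFredholm) :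
    ind (blockOp A B W) = ind B + ind A := by
  have hid : (ContinuousLinearMap.id ℂ E).toLinearMap.index = 0 := LinearMap.index_id
  have hshear : (shearSwap W : E × E →L[ℂ] E × E).toLinearMap.index = 0 :=
    LinearEquiv.index_eq_zero (e := (shearSwap W).toLinearEquiv)
  rw [ind, blockOp_eq_comp, index_comp_of_isFredholm (isFredholm_prodMap hB isFredholm_id)
    (isFredholm_comp (isFredholm_of_equiv _) (isFredholm_prodMap hA isFredholm_id)),
    index_comp_of_isFredholm (isFredholm_of_equiv _) (isFredholm_prodMap hA isFredholm_id),
    index_prodMap_of_isFredholm hB isFredholm_id, index_prodMap_of_isFredholm hA isFredholm_id,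
    hid, hshear]
  simp [ind]

lemma dimKer_blockOp_of_surjective (hA : Function.Surjective A) :
    dimKer (blockOp A B W) = dimKer (B.prodMap A) := by
  obtain ⟨s, hs⟩ := A.toLinearMap.exists_rightInverse_of_surjective (LinearMap.range_eq_top.2 hA)
  have hs' : ∀ y, A (s y) = y := fun y ↦ LinearMap.congr_fun hs y
  -- The substitution `f' = f + s (W g)`, with `s` a right inverse of `A`, removes `W`.
  let Φ : (E × E) ≃ₗ[ℂ] E × E := LinearEquiv.ofLinearMap
    ((LinearMap.snd ℂ E E).prod (LinearMap.fst ℂ E E + s ∘ₗ W.toLinearMap ∘ₗ LinearMap.snd ℂ E E))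
    ((LinearMap.snd ℂ E E - s ∘ₗ W.toLinearMap ∘ₗ LinearMap.fst ℂ E E).prod (LinearMap.fst ℂ E E))
    (by ext <;> simp) (by ext <;> simp)
  have hΦ : ∀ x, Φ x = (x.2, x.1 + s (W x.2)) := fun x ↦ rfl
  have hker : (blockOp A B W).toLinearMap.ker =
      (B.prodMap A).toLinearMap.ker.comap (Φ : (E × E) →ₗ[ℂ] E × E) := by
    ext x
    rw [Submodule.mem_comap, LinearMap.mem_ker, LinearMap.mem_ker]
    change blockOp A B W x = 0 ↔ B.prodMap A (Φ x) = 0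
    simp [blockOp_apply, hΦ, hs', Prod.ext_iff]
  rw [dimKer, hker]
  exact (Φ.ofSubmodule' (B.prodMap A).toLinearMap.ker).rank_eq

lemma dimKer_blockOp_of_injective (hA : Function.Injective A) (hB : Function.Injective B) :
    dimKer (blockOp A B W) = dimKer (B.prodMap A) := by
  have h1 : (blockOp A B W).toLinearMap.ker = ⊥ := by
    refine LinearMap.ker_eq_bot'.2 fun x hx ↦ ?_
    have hx' : blockOp A B W x = 0 := hx
    rw [blockOp_apply, Prod.mk_eq_zero, neg_eq_zero, map_eq_zero_iff B hB] at hx'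
    obtain ⟨h1, h2⟩ := hx'
    rw [h1, map_zero, add_zero, map_eq_zero_iff A hA] at h2
    exact Prod.ext h2 h1
  have h2 : (B.prodMap A).toLinearMap.ker = ⊥ := LinearMap.ker_eq_bot.2 (hB.prodMap hA)
  rw [dimKer, dimKer, h1, h2]

/-- If `A = A₀ S` with `A₀` bijective and `S` injective, then `A f = -W g` is solvable for `f`
precisely when `A₀⁻¹ W g` lies in the range of `S`. -/
lemma dimKer_blockOp_of_factorization {A₀ S P : E →L[ℂ] E} (hA₀ : A₀.IsInvertible)
    (hS : Function.Injective S) (hPS : ∀ y, P y = 0 ↔ ∃ x, S x = y) (hA : A = A₀ ∘L S) :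
    dimKer (blockOp A B W) = dimKerOn (P ∘L A₀.inverse ∘L W) B.toLinearMap.ker := by
  obtain ⟨e, rfl⟩ := hA₀
  subst hA
  let N := ((P ∘L (e : E →L[ℂ] E).inverse ∘L W).toLinearMap.domRestrict B.toLinearMap.ker).ker
  have hinv : ∀ y, (e : E →L[ℂ] E).inverse y = e.symm y := fun y ↦ by simp
  have hker : ∀ x : E × E, x ∈ (blockOp (e ∘L S) B W).toLinearMap.ker ↔
      B x.2 = 0 ∧ S x.1 = -e.symm (W x.2) := fun x ↦ by
    rw [LinearMap.mem_ker]
    change blockOp (e ∘L S) B W x = 0 ↔ _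
    rw [blockOp_apply, Prod.mk_eq_zero, neg_eq_zero, ← map_neg, ContinuousLinearEquiv.eq_symm_apply,
      ← eq_neg_iff_add_eq_zero]
    rfl
  have hN : ∀ g : B.toLinearMap.ker, g ∈ N ↔ P (e.symm (W g)) = 0 := fun g ↦ by
    change P ((e : E →L[ℂ] E).inverse (W g)) = 0 ↔ _
    rw [hinv]
  let Φ : (blockOp (e ∘L S) B W).toLinearMap.ker →ₗ[ℂ] N :=
    LinearMap.codRestrict N (LinearMap.codRestrict B.toLinearMap.ker
      (LinearMap.snd ℂ E E ∘ₗ Submodule.subtype _) fun x ↦ ((hker x).1 x.2).1) fun x ↦ by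
        rw [hN, hPS]
        refine ⟨-(x : E × E).1, ?_⟩
        rw [map_neg, ((hker x).1 x.2).2, neg_neg]
        rfl
  have hΦ : ∀ x, ((Φ x : B.toLinearMap.ker) : E) = (x : E × E).2 := fun x ↦ rfl
  have hbij : Function.Bijective Φ := by
    constructor
    · rw [← LinearMap.ker_eq_bot, LinearMap.ker_eq_bot']
      intro x hx
      have h2 : (x : E × E).2 = 0 := by rw [← hΦ, hx]; rfl
      have h1 := ((hker x).1 x.2).2
      rw [h2, map_zero, map_zero, neg_zero, map_eq_zero_iff S hS] at h1
      exact Subtype.ext (Prod.ext h1 h2)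
    · rintro ⟨g, hg⟩
      obtain ⟨f, hf⟩ := (hPS _).1 ((hN g).1 hg)
      exact ⟨⟨(-f, (g : E)), (hker _).2 ⟨g.2, by rw [map_neg, hf]⟩⟩, rfl⟩
  exact (LinearEquiv.ofBijective Φ hbij).rank_eq

/-- Transport of the dimension of the kernel of a restriction along an invertible operator. -/
lemma dimKerOn_comp_inverse {B₀ : E →L[ℂ] E} (hB₀ : B₀.IsInvertible) (K : E →L[ℂ] E)
    {M N : Submodule ℂ E} (hMN : ∀ x, x ∈ M ↔ B₀ x ∈ N) :
    dimKerOn K M = dimKerOn (K ∘L B₀.inverse) N := by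
  obtain ⟨e, rfl⟩ := hB₀
  have hinv : ∀ y, (e : E →L[ℂ] E).inverse y = e.symm y := fun y ↦ by simp
  have hM : M = N.comap (e.toLinearEquiv : E →ₗ[ℂ] E) := by ext x; exact hMN x
  subst hM
  let Φ := e.toLinearEquiv.ofSubmodule' N
  have hker : (K.toLinearMap.domRestrict (N.comap (e.toLinearEquiv : E →ₗ[ℂ] E))).ker =
      (((K ∘L (e : E →L[ℂ] E).inverse).toLinearMap.domRestrict N).ker).comap
        (Φ : _ →ₗ[ℂ] N) := by
    ext x
    change K x = 0 ↔ K ((e : E →L[ℂ] E).inverse (e x)) = 0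
    rw [hinv, e.symm_apply_apply]
  rw [dimKerOn, hker]
  exact (Φ.ofSubmodule' _).rank_eq

end Block

/-! ### Coburn's lemma -/

section Coburn

variable {p : ℝ≥0∞} [Fact (1 ≤ p)]

/-- Multiplication by a symbol whose Toeplitz operator has a finite dimensional kernel is
injective on the Hardy space: its kernel is invariant under the shift `T(t)`, which, being injective,
would act bijectively on it, whereas no nonzero function is divisible by all powers of `t`. -/
lemma eq_zero_of_mulOp_eq_zero (hp₁ : 1 < p) (hp₂ : p < ∞) {u : Symb}
    (hfin : FiniteDimensional ℂ (toeplitz p u).ker) {f : Hardy p}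
    (hf : mulOp p u (f : LpT p) = 0) : f = 0 := by
  let N : Submodule ℂ (Hardy p) := ((mulOp p u).toLinearMap ∘ₗ (Hardy p).subtype).ker
  have hN : ∀ g : Hardy p, g ∈ N ↔ mulOp p u (g : LpT p) = 0 := fun g ↦ Iff.rfl
  have hle : N ≤ (toeplitz p u).ker := fun g hg ↦ by
    change toeplitz p u g = 0
    rw [toeplitz_apply, (hN g).1 hg, map_zero]
  have : FiniteDimensional ℂ N := Submodule.finiteDimensional_of_le hle
  have hmaps : ∀ g ∈ N, toeplitz p (tPow 1) g ∈ N := fun g hg ↦ by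
    rw [hN, coe_toeplitz_tPow_of_nonneg hp₁ hp₂ zero_le_one, mulOp_mulOp_comm, (hN g).1 hg,
      map_zero]
  let S : N →ₗ[ℂ] N := (toeplitz p (tPow 1)).toLinearMap.restrict hmaps
  have hS : ∀ g, ((S g : N) : Hardy p) = toeplitz p (tPow 1) g := fun g ↦ rfl
  have hinj : Function.Injective S := by
    intro g g' h
    have h1 : toeplitz p (tPow 1) (g : Hardy p) = toeplitz p (tPow 1) (g' : Hardy p) := by
      rw [← hS, ← hS, h]
    have h2 := congrArg (toeplitz p (tPow (-1))) h1
    rw [toeplitz_tPow_neg_toeplitz_tPow hp₁ hp₂ zero_le_one,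
      toeplitz_tPow_neg_toeplitz_tPow hp₁ hp₂ zero_le_one] at h2
    exact Subtype.ext h2
  have hsurj : Function.Surjective S := LinearMap.injective_iff_surjective.1 hinj
  have hcoeff : ∀ n : ℕ, ∀ g ∈ N, coeff p n (g : LpT p) = 0 := by
    intro n
    induction n with
    | zero =>
      intro g hg
      obtain ⟨g', hg'⟩ := hsurj ⟨g, hg⟩
      have : toeplitz p (tPow 1) (g' : Hardy p) = g := by rw [← hS, hg']
      rw [← this, coeff_toeplitz_tPow hp₁ hp₂ _ _ (by simp)]
      exact coeff_hardy_of_neg _ (by simp)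
    | succ n ih =>
      intro g hg
      obtain ⟨g', hg'⟩ := hsurj ⟨g, hg⟩
      have : toeplitz p (tPow 1) (g' : Hardy p) = g := by rw [← hS, hg']
      rw [← this, coeff_toeplitz_tPow hp₁ hp₂ _ _ (by lia)]
      have := ih g' g'.2
      push_cast
      rwa [add_sub_cancel_right]
  refine ext_coeff_hardy fun n hn ↦ ?_
  lift n to ℕ using hn
  rw [hcoeff n f hf, ZeroMemClass.coe_zero, map_zero]

lemma riesz_fourierLp (hp₁ : 1 < p) (hp₂ : p < ∞) (n : ℕ) :
    riesz p (fourierLp p n) = monomial p n :=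
  riesz_hardy hp₁ hp₂ (monomial p n)

lemma riesz_fourierLp_of_neg (hp₁ : 1 < p) (hp₂ : p < ∞) {n : ℤ} (hn : n < 0) :
    riesz p (fourierLp p n) = 0 :=
  ext_coeff_hardy fun m hm ↦ by
    rw [coeff_riesz hp₁ hp₂ _ hm, coeff_fourierLp, if_neg (by lia), ZeroMemClass.coe_zero, map_zero]

/-- Polynomials are dense in the Hardy space. -/
lemma functional_eq_zero_of_monomial (hp₁ : 1 < p) (hp₂ : p < ∞) {φ : Hardy p →L[ℂ] ℂ}
    (h : ∀ n, φ (monomial p n) = 0) : φ = 0 := by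
  have hspan : Submodule.span ℂ (Set.range (@fourierLp (2 * Real.pi) _ p _)) ≤
      (φ ∘L riesz p).ker := by
    rw [Submodule.span_le]
    rintro _ ⟨n, rfl⟩
    change φ (riesz p (fourierLp p n)) = 0
    rcases lt_or_ge n 0 with hn | hn
    · rw [riesz_fourierLp_of_neg hp₁ hp₂ hn, map_zero]
    · lift n to ℕ using hn
      rw [riesz_fourierLp hp₁ hp₂, h]
  have htop := Submodule.topologicalClosure_minimal _ hspan (φ ∘L riesz p).isClosed_ker
  rw [span_fourierLp_closure_eq_top hp₂.ne] at htop
  ext1 f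
  have h1 : φ (riesz p (f : LpT p)) = 0 := htop (Submodule.mem_top : (f : LpT p) ∈ ⊤)
  rwa [riesz_hardy hp₁ hp₂] at h1

/-- Coburn's lemma. If `T(u) f = 0`, then `u f` has only negative frequencies, so that
`T(u) (t ^ k f)` is a polynomial for all `k`. If a functional `φ` vanishes on the range of `T(u)`,
the power series with coefficients `φ (t ^ i)` and the one with the coefficients of `u f`
therefore have product zero, and one of them vanishes. -/
theorem injective_or_surjective_of_isFredholm (hp₁ : 1 < p) (hp₂ : p < ∞) {u : Symb}
    (hu : (toeplitz p u).IsFredholm) :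
    Function.Injective (toeplitz p u) ∨ Function.Surjective (toeplitz p u) := by
  by_contra! ⟨hinj, hsurj⟩
  obtain ⟨f, hf, hf0⟩ : ∃ f, toeplitz p u f = 0 ∧ f ≠ 0 := by
    rw [injective_iff_map_eq_zero] at hinj
    push Not at hinj
    exact hinj
  obtain ⟨φ, hφ, hφu⟩ := exists_functional_of_not_surjective hu hsurj
  set h : LpT p := mulOp p u (f : LpT p) with hh
  have hneg : ∀ n : ℤ, 0 ≤ n → coeff p n h = 0 := fun n hn ↦ by
    rw [← coeff_riesz hp₁ hp₂ h hn, hh, ← toeplitz_apply, hf, ZeroMemClass.coe_zero, map_zero]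
  have hshift : ∀ k : ℕ, toeplitz p u (toeplitz p (tPow k) f) =
      ∑ i ∈ Finset.range k, coeff p (i - k) h • monomial p i := fun k ↦ by
    have h1 : ∀ n : ℕ, coeff p n (toeplitz p u (toeplitz p (tPow k) f) : LpT p) =
        coeff p (n - k) h := fun n ↦ by
      rw [toeplitz_apply, coeff_riesz hp₁ hp₂ _ (by lia),
        coe_toeplitz_tPow_of_nonneg hp₁ hp₂ (by lia), mulOp_mulOp_comm, coeff_mulOp_tPow]
    rw [eq_sum_monomial (toeplitz p u (toeplitz p (tPow k) f)) k fun n hn ↦ by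
      rw [h1, hneg _ (by lia)]]
    exact Finset.sum_congr rfl fun i _ ↦ by rw [h1]
  let Φ : PowerSeries ℂ := PowerSeries.mk fun i ↦ φ (monomial p i)
  let H : PowerSeries ℂ := PowerSeries.mk fun j ↦ coeff p (-(j + 1)) h
  have hprod : Φ * H = 0 := by
    ext m
    rw [PowerSeries.coeff_mul, Finset.Nat.sum_antidiagonal_eq_sum_range_succ_mk, map_zero,
      ← hφu (toeplitz p (tPow (m + 1 : ℕ)) f), hshift, map_sum]
    refine Finset.sum_congr rfl fun i hi ↦ ?_
    have hi' := Finset.mem_range.1 hi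
    simp only [Φ, H, PowerSeries.coeff_mk, map_smul, smul_eq_mul]
    rw [mul_comm]
    congr 3
    push_cast [Nat.lt_succ_iff.1 hi']
    ring
  rcases mul_eq_zero.1 hprod with h0 | h0
  · refine hφ (functional_eq_zero_of_monomial hp₁ hp₂ fun n ↦ ?_)
    have := congrArg (PowerSeries.coeff n) h0
    simpa [Φ] using this
  · refine hf0 (eq_zero_of_mulOp_eq_zero hp₁ hp₂ hu.finite_ker (ext_coeff fun n ↦ ?_))
    rw [map_zero]
    rcases lt_or_ge n 0 with hn | hn
    · have := congrArg (PowerSeries.coeff (-n - 1).toNat) h0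
      simp only [H, PowerSeries.coeff_mk, map_zero] at this
      rwa [Int.toNat_of_nonneg (by lia), sub_add_cancel, neg_neg] at this
    · exact hneg n hn

lemma toeplitz_surjective (hp₁ : 1 < p) (hp₂ : p < ∞) {u : Symb}
    (hu : (toeplitz p u).IsFredholm) (hind : 0 ≤ ind (toeplitz p u)) :
    Function.Surjective (toeplitz p u) :=
  (injective_or_surjective_of_isFredholm hp₁ hp₂ hu).elim
    (fun h ↦ surjective_of_injective_of_index_nonneg hu h hind) id

lemma toeplitz_injective (hp₁ : 1 < p) (hp₂ : p < ∞) {u : Symb}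
    (hu : (toeplitz p u).IsFredholm) (hind : ind (toeplitz p u) ≤ 0) :
    Function.Injective (toeplitz p u) :=
  (injective_or_surjective_of_isFredholm hp₁ hp₂ hu).elim id
    (fun h ↦ injective_of_surjective_of_index_nonpos hu h hind)

lemma isInvertible_toeplitz (hp₁ : 1 < p) (hp₂ : p < ∞) {u : Symb}
    (hu : (toeplitz p u).IsFredholm) (hind : ind (toeplitz p u) = 0) :
    (toeplitz p u).IsInvertible :=
  isInvertible_of_bijective
    ⟨toeplitz_injective hp₁ hp₂ hu hind.le, toeplitz_surjective hp₁ hp₂ hu hind.ge⟩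

/-! ### Shifts -/

lemma toeplitz_tPow_neg_comp (hp₁ : 1 < p) (hp₂ : p < ∞) (k : ℕ) :
    toeplitz p (tPow (-k)) ∘L toeplitz p (tPow k) = .id ℂ (Hardy p) :=
  ContinuousLinearMap.ext fun f ↦ toeplitz_tPow_neg_toeplitz_tPow hp₁ hp₂ (by lia) f

open LinearMap.FiniteRangeSetoid in
lemma isFredholm_toeplitz_tPow (hp₁ : 1 < p) (hp₂ : p < ∞) (k : ℕ) :
    (toeplitz p (tPow k)).IsFredholm := by
  have hle : (toeplitz p (tPow k) ∘L toeplitz p (tPow (-k)) - .id ℂ (Hardy p)).toLinearMap.range ≤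
      (toeplitz p (tPow (-k))).ker := by
    rintro _ ⟨f, rfl⟩
    change toeplitz p (tPow (-k)) (toeplitz p (tPow k) (toeplitz p (tPow (-k)) f) - f) = 0
    rw [map_sub, toeplitz_tPow_neg_toeplitz_tPow hp₁ hp₂ (by lia), sub_self]
  refine .of_isQuasiInverse (v := toeplitz p (tPow (-k))) ⟨?_, ?_⟩
  · refine equiv_iff_hasNoetherianRange.2
      ((congrArg LinearMap.HasNoetherianRange (LinearMap.ext fun f ↦ ?_)).mp .zero)
    have h := toeplitz_tPow_neg_toeplitz_tPow hp₁ hp₂ (k := k) (by lia) f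
    exact (sub_eq_zero.2 h).symm
  · refine equiv_iff_hasNoetherianRange.2 ?_
    obtain ⟨e⟩ := nonempty_ker_toeplitz_tPow_neg_equiv hp₁ hp₂ k
    have : FiniteDimensional ℂ (toeplitz p (tPow (-k))).ker := Module.Finite.equiv e.symm
    exact isNoetherian_of_le hle

lemma isFredholm_toeplitz_tPow_neg (hp₁ : 1 < p) (hp₂ : p < ∞) (k : ℕ) :
    (toeplitz p (tPow (-k))).IsFredholm :=
  isFredholm_of_comp_left (by rw [toeplitz_tPow_neg_comp hp₁ hp₂]; exact isFredholm_id)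
    (isFredholm_toeplitz_tPow hp₁ hp₂ k)

lemma ind_toeplitz_tPow_neg (hp₁ : 1 < p) (hp₂ : p < ∞) (k : ℕ) :
    ind (toeplitz p (tPow (-k))) = k := by
  rw [ind, LinearMap.index_of_surjective (fun f ↦
    ⟨_, toeplitz_tPow_neg_toeplitz_tPow hp₁ hp₂ (k := k) (by lia) f⟩)]
  obtain ⟨e⟩ := nonempty_ker_toeplitz_tPow_neg_equiv hp₁ hp₂ k
  exact congrArg _ (e.finrank_eq.trans (Module.finrank_fin_fun ℂ))

lemma ind_toeplitz_tPow (hp₁ : 1 < p) (hp₂ : p < ∞) (k : ℕ) :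
    ind (toeplitz p (tPow k)) = -k := by
  have h := index_comp_of_isFredholm (isFredholm_toeplitz_tPow_neg hp₁ hp₂ k)
    (isFredholm_toeplitz_tPow hp₁ hp₂ k)
  rw [toeplitz_tPow_neg_comp hp₁ hp₂] at h
  have h0 : (ContinuousLinearMap.id ℂ (Hardy p)).toLinearMap.index = 0 := LinearMap.index_id
  have h1 := ind_toeplitz_tPow_neg hp₁ hp₂ k
  rw [ind] at *
  lia

lemma partialSum_apply (k : ℤ) (f : Hardy p) :
    partialSum p (k - 1) f = f - toeplitz p (tPow k) (toeplitz p (tPow (-k)) f) := by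
  rw [partialSum, sub_add_cancel]
  rfl

lemma partialSum_eq_zero_iff (hp₁ : 1 < p) (hp₂ : p < ∞) (k : ℕ) (f : Hardy p) :
    partialSum p (k - 1) f = 0 ↔ ∃ g, toeplitz p (tPow k) g = f := by
  rw [partialSum_apply, sub_eq_zero]
  constructor
  · exact fun h ↦ ⟨_, h.symm⟩
  · rintro ⟨g, rfl⟩
    rw [toeplitz_tPow_neg_toeplitz_tPow hp₁ hp₂ (by lia)]

lemma mem_range_partialSum_iff (hp₁ : 1 < p) (hp₂ : p < ∞) (k : ℕ) (f : Hardy p) :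
    f ∈ (partialSum p (k - 1)).toLinearMap.range ↔ toeplitz p (tPow (-k)) f = 0 := by
  constructor
  · rintro ⟨g, rfl⟩
    change toeplitz p (tPow (-k)) (partialSum p (k - 1) g) = 0
    rw [partialSum_apply, map_sub, toeplitz_tPow_neg_toeplitz_tPow hp₁ hp₂ (by lia), sub_self]
  · intro h
    refine ⟨f, ?_⟩
    change partialSum p (k - 1) f = f
    rw [partialSum_apply, h, map_zero, sub_zero]

end Coburn

/-! ### Triangular matrix symbols -/

lemma toeplitzMatrix_eq_blockOp (p : ℝ≥0∞) [Fact (1 ≤ p)] (u v w : Symb) :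
    toeplitzMatrix p !![0, -v; u, w] = blockOp (toeplitz p u) (toeplitz p v) (toeplitz p w) := by
  have h0 : mulOp p (0 : Symb) = 0 := map_zero _
  refine ContinuousLinearMap.ext fun x ↦ Prod.ext ?_ ?_
  · change riesz p (mulOp p 0 x.1 + mulOp p (-v) x.2) = -toeplitz p v x.2
    rw [h0, zero_apply, zero_add, ← toeplitz_apply, toeplitz_neg, neg_apply]
  · change riesz p (mulOp p u x.1 + mulOp p w x.2) = toeplitz p u x.1 + toeplitz p w x.2
    rw [map_add]
    rfl

/-- Associativity over an abstract space `E`. It holds definitionally there, which is expensive to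
check directly for operators on Hardy spaces. -/
lemma comp_comp_comp_assoc {E : Type*} [NormedAddCommGroup E] [NormedSpace ℂ E]
    (X Y W Z : E →L[ℂ] E) : (X ∘L Y ∘L W) ∘L Z = X ∘L Y ∘L W ∘L Z := rfl

variable {p : ℝ≥0∞} [Fact (1 ≤ p)]

/-! ### The case of a surjective and an injective diagonal entry -/

lemma isInvertible_toeplitz_symbMul_tPow_neg (hp₁ : 1 < p) (hp₂ : p < ∞) {u : Symb} {n : ℕ}
    (hu : (toeplitz p u).IsFredholm) (h : ind (toeplitz p u) = -n) :
    (toeplitz p (symbMul u (tPow (-n)))).IsInvertible := by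
  have hT := toeplitz_symbMul_tPow_of_nonpos hp₁ hp₂ u (k := -n) (by lia)
  have hi := index_comp_of_isFredholm (isFredholm_toeplitz_tPow_neg hp₁ hp₂ n) hu
  have hf := isFredholm_comp (isFredholm_toeplitz_tPow_neg hp₁ hp₂ n) hu
  have h1 := ind_toeplitz_tPow_neg hp₁ hp₂ n
  rw [← hT] at hi hf
  rw [ind] at h h1
  refine isInvertible_toeplitz hp₁ hp₂ hf ?_
  rw [ind, hi, h, h1, add_neg_cancel]

lemma isInvertible_toeplitz_symbMul_tPow (hp₁ : 1 < p) (hp₂ : p < ∞) {v : Symb} {m : ℕ}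
    (hv : (toeplitz p v).IsFredholm) (h : ind (toeplitz p v) = m) :
    (toeplitz p (symbMul v (tPow m))).IsInvertible := by
  have hT := toeplitz_symbMul_tPow_of_nonneg hp₁ hp₂ v (k := m) (by lia)
  have hi := index_comp_of_isFredholm hv (isFredholm_toeplitz_tPow hp₁ hp₂ m)
  have hf := isFredholm_comp hv (isFredholm_toeplitz_tPow hp₁ hp₂ m)
  have h1 := ind_toeplitz_tPow hp₁ hp₂ m
  rw [← hT] at hi hf
  rw [ind] at h h1
  refine isInvertible_toeplitz hp₁ hp₂ hf ?_
  rw [ind, hi, h, h1, add_neg_cancel]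

/-- With `n = -ind T(u)` the left factor is invertible. -/
lemma toeplitz_eq_comp_tPow (hp₁ : 1 < p) (hp₂ : p < ∞) (u : Symb) (n : ℕ) :
    toeplitz p u = toeplitz p (symbMul u (tPow (-n))) ∘L toeplitz p (tPow n) := by
  rw [← toeplitz_symbMul_tPow_of_nonneg hp₁ hp₂ _ (by lia)]
  have h := symbMul_symbMul_tPow_neg u (-(n : ℤ))
  rw [neg_neg] at h
  rw [h]

/-- With `m = ind T(v)` the right factor is invertible. -/
lemma toeplitz_eq_tPow_comp (hp₁ : 1 < p) (hp₂ : p < ∞) (v : Symb) (m : ℕ) :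
    toeplitz p v = toeplitz p (tPow (-m)) ∘L toeplitz p (symbMul v (tPow m)) := by
  rw [← toeplitz_symbMul_tPow_of_nonpos hp₁ hp₂ _ (by lia), symbMul_symbMul_tPow_neg]

lemma dimKer_blockOp_toeplitz (hp₁ : 1 < p) (hp₂ : p < ∞) {u : Symb} (v w : Symb) (n : ℕ)
    (hinv : (toeplitz p (symbMul u (tPow (-n)))).IsInvertible) :
    dimKer (blockOp (toeplitz p u) (toeplitz p v) (toeplitz p w)) =
      dimKerOn (partialSum p (n - 1) ∘L (toeplitz p (symbMul u (tPow (-n)))).inverse ∘L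
        toeplitz p w) (toeplitz p v).toLinearMap.ker := by
  have hinj : Function.Injective (toeplitz p (tPow n)) := fun f g h ↦ by
    rw [← toeplitz_tPow_neg_toeplitz_tPow hp₁ hp₂ (k := n) (by lia) f, h,
      toeplitz_tPow_neg_toeplitz_tPow hp₁ hp₂ (by lia)]
  exact dimKer_blockOp_of_factorization _ hinv hinj (partialSum_eq_zero_iff hp₁ hp₂ n)
    (toeplitz_eq_comp_tPow hp₁ hp₂ u n)

lemma dimKerOn_ker_toeplitz (hp₁ : 1 < p) (hp₂ : p < ∞) {v : Symb} (m : ℕ)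
    (hinv : (toeplitz p (symbMul v (tPow m))).IsInvertible) (X Y W : Hardy p →L[ℂ] Hardy p) :
    dimKerOn (X ∘L Y ∘L W) (toeplitz p v).toLinearMap.ker =
      dimKerOn (X ∘L Y ∘L W ∘L (toeplitz p (symbMul v (tPow m))).inverse)
        (partialSum p (m - 1)).toLinearMap.range := by
  rw [← comp_comp_comp_assoc]
  refine dimKerOn_comp_inverse hinv _ fun f ↦ ?_
  rw [mem_range_partialSum_iff hp₁ hp₂, LinearMap.mem_ker, ContinuousLinearMap.coe_coe,
    toeplitz_eq_tPow_comp hp₁ hp₂ v m, ContinuousLinearMap.comp_apply]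

end ToeplitzCircle

end

open ToeplitzCircle in
theorem mainTheorem5 (p : ℝ≥0∞) [Fact (1 ≤ p)] (hp₁ : 1 < p) (hp₂ : p < ∞)
    (u v w : Symb)
    (huv : (toeplitz p u).IsFredholm ∨ (toeplitz p v).IsFredholm) :
    ((toeplitzMatrix p !![0, -v; u, w]).IsFredholm ↔
      (toeplitz p u).IsFredholm ∧ (toeplitz p v).IsFredholm) ∧
    ((toeplitz p u).IsFredholm → (toeplitz p v).IsFredholm →
      ind (toeplitzMatrix p !![0, -v; u, w]) = ind ((toeplitz p v).prodMap (toeplitz p u)) ∧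
      ind ((toeplitz p v).prodMap (toeplitz p u)) = ind (toeplitz p v) + ind (toeplitz p u) ∧
      ∀ κ₁ κ₂ : ℤ, κ₁ = ind (toeplitz p v) → κ₂ = ind (toeplitz p u) →
        (((0 ≤ κ₁ ∧ 0 ≤ κ₂) ∨ (κ₁ < 0 ∧ 0 ≤ κ₂) ∨ (κ₁ < 0 ∧ κ₂ < 0)) →
          dimKer (toeplitzMatrix p !![0, -v; u, w]) =
            dimKer ((toeplitz p v).prodMap (toeplitz p u))) ∧
        ((0 ≤ κ₁ ∧ κ₂ < 0) →
          ∀ u₀ v₀ : Symb, u₀ = symbMul u (tPow κ₂) → v₀ = symbMul v (tPow κ₁) →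
            (toeplitz p u₀).IsInvertible ∧ (toeplitz p v₀).IsInvertible ∧
            dimKer (toeplitzMatrix p !![0, -v; u, w]) =
              dimKerOn (partialSum p (-κ₂ - 1) ∘L (toeplitz p u₀).inverse ∘L toeplitz p w)
                (LinearMap.ker (toeplitz p v).toLinearMap) ∧
            dimKer (toeplitzMatrix p !![0, -v; u, w]) =
              dimKerOn (partialSum p (-κ₂ - 1) ∘L (toeplitz p u₀).inverse ∘L toeplitz p w ∘L
                  (toeplitz p v₀).inverse)
                (LinearMap.range (partialSum p (κ₁ - 1)).toLinearMap))) := by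
  rw [toeplitzMatrix_eq_blockOp]
  refine ⟨⟨fun h ↦ huv.elim (fun hu ↦ ⟨hu, isFredholm_right_of_blockOp _ h hu⟩)
    (fun hv ↦ ⟨isFredholm_left_of_blockOp _ h hv, hv⟩),
    fun h ↦ isFredholm_blockOp _ h.1 h.2⟩, fun hu hv ↦ ?_⟩
  have hdiag : ind ((toeplitz p v).prodMap (toeplitz p u)) =
      ind (toeplitz p v) + ind (toeplitz p u) := index_prodMap_of_isFredholm hv hu
  refine ⟨(ind_blockOp _ hu hv).trans hdiag.symm, hdiag, ?_⟩
  intro κ₁ κ₂ hκ₁ hκ₂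
  refine ⟨fun hκ ↦ ?_, ?_⟩
  · rcases lt_or_ge κ₂ 0 with h2 | h2
    · exact dimKer_blockOp_of_injective _ (toeplitz_injective hp₁ hp₂ hu (by lia))
        (toeplitz_injective hp₁ hp₂ hv (by lia))
    · exact dimKer_blockOp_of_surjective _ (toeplitz_surjective hp₁ hp₂ hu (by lia))
  rintro ⟨h1, h2⟩ u₀ v₀ hu₀ hv₀
  obtain ⟨m, hm⟩ := Int.eq_ofNat_of_zero_le h1
  obtain ⟨n, hn⟩ := Int.eq_ofNat_of_zero_le (neg_nonneg.2 h2.le)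
  have hn' : κ₂ = -n := by lia
  have hinvu := isInvertible_toeplitz_symbMul_tPow_neg hp₁ hp₂ hu (hκ₂.symm.trans hn')
  have hinvv := isInvertible_toeplitz_symbMul_tPow hp₁ hp₂ hv (hκ₁.symm.trans hm)
  have hker := dimKer_blockOp_toeplitz hp₁ hp₂ v w n hinvu
  have hker' := hker.trans (dimKerOn_ker_toeplitz hp₁ hp₂ m hinvv _ _ _)
  rw [← hn'] at hinvu hker hker'
  rw [← hm] at hinvv hker'
  rw [← hu₀] at hinvu hker hker'
  rw [← hv₀] at hinvv hker'
  rw [← hn] at hker hker'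
  exact ⟨hinvu, hinvv, hker, hker'⟩
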